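/- There is an absolute constant $C>0$ such that the following holds. Let $d_x,d_y,n,r$ be nonnegative integers, $A^\star, A_0\in\mathbb R^{d_y\times d_x}$ (the ground truth and the pre-trained model), and $\Delta^\star=A^\star-A_0$. Let $\mathbb P_{x,y}$ be the law of a pair $(x,y)$ with $y=A^\star x+\varepsilon$, where $x\in\mathbb R^{d_x}$ is square-integrable, $\Sigma_{xx}=\mathbb E[xx^\top]$ has full rank, and $\varepsilon\sim\mathcal N(0,\Sigma_{\varepsilon\varepsilon})$ is independent of $x$ ($\Sigma_{\varepsilon\varepsilon}\succeq 0$). Let $(x_1,y_1),\dots,(x_n,y_n)$ be i.i.d. with law $\mathbb P_{x,y}$, let $X=[x_1,\dots,x_n]$, $Y=[y_1,\dots,y_n]$, $\widehat\Sigma_{xx}=\frac1n XX^\top$, and assume that $\widehat\Sigma_{xx}$ is almost surely invertible (in particular $n\ge d_x$: the overdetermined regime). Let $\widehat A_{\mathrm{LoRA}}$ be a measurable random matrix that is almost surely a LoRA solution, that is, either a minimizer of $\|AX-Y\|_F^2$ over $\{A:\operatorname{rank}(A-A_0)\le r\}$ that is closest to $A_0$ in Frobenius norm among all such minimizers, or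 a matrix of the form $$A_0+\big[(Y-A_0X)X^\dagger\,\widehat\Sigma_{xx}^{1/2}\big]_r\big(\widehat\Sigma_{xx}^{1/2}\big)^\dagger,$$ where ${}^\dagger$ is the Moore--Penrose inverse and $[\cdot]_r$ a truncation to the top $r$ singular values (the two coincide when the truncation is unique). Write $\mathcal R(A)=\mathbb E_{(x,y)\sim\mathbb P_{x,y}}\|Ax-y\|^2$, and let $\sigma_1\ge\sigma_2\ge\cdots$ denote singular values and $\lambda_{\max}$ the largest eigenvalue. Suppose $\operatorname{rank}(\Delta^\star)\le r<\min\{d_x,d_y\}<n$. Then the bias terms $$\lambda_{\max}(\Sigma_{xx})\Big(r\,\sigma_{r+1}^2(\Delta^\star)+\sum_{i=r+1}^{\min\{d_x,d_y\}}\sigma_i^2(\Delta^\star)\Big)\quad\text{and}\quad r\,\sigma_{r+1}^2(\Delta^\star)\,\mathbb E\big[\lambda_{\max}(\widehat\Sigma_{xx})\,\lambda_{\max}(\Sigma_{xx}\widehat\Sigma_{xx}^{-1})\big]$$ are zero, $\mathcal R(A^\star)<\infty$, and $$\mathbb E\big[\mathcal R(\widehat A_{\mathrm{LoRA}})\big]-\mathcal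 R(A^\star)\;\le\; C\,\frac{r\max\{d_x,d_y\}}{n}\,\lambda_{\max}(\Sigma_{\varepsilon\varepsilon})\;\mathbb E\big[\lambda_{\max}\big(\Sigma_{xx}\widehat\Sigma_{xx}^{-1}\big)\big].$$ Expectations of nonnegative quantities are taken in $[0,\infty]$, with $0\cdot\infty=0$. -/

import Mathlib

open MeasureTheory ProbabilityTheory
open scoped ENNReal Matrix

namespace LoRA

noncomputable section

/-! ### Matrix notions -/

/-- The squared Frobenius norm. -/
def frobSq {m n : ℕ} (A : Matrix (Fin m) (Fin n) ℝ) : ℝ :=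
  ∑ i, ∑ j, A i j ^ 2

/-- The largest (real) eigenvalue of a square real matrix. It is used for positive semidefinite
matrices and for products of two of them, whose eigenvalues are all real. -/
def lambdaMax {d : ℕ} (A : Matrix (Fin d) (Fin d) ℝ) : ℝ :=
  sSup (spectrum ℝ A)

/-- The `i`-th singular value (in decreasing order, counted from `i = 1`) of a real matrix. -/
def sigma {m n : ℕ} (A : Matrix (Fin m) (Fin n) ℝ) (i : ℕ) : ℝ :=
  (Matrix.toEuclideanLin A).singularValues (i - 1)

/-- `P` is the Moore-Penrose inverse of `A` (the four Penrose equations). -/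
structure IsMoorePenroseInverse {m n : ℕ} (A : Matrix (Fin m) (Fin n) ℝ)
    (P : Matrix (Fin n) (Fin m) ℝ) : Prop where
  mul_mul_self : A * P * A = A
  self_mul_mul : P * A * P = P
  symm_left : (A * P)ᵀ = A * P
  symm_right : (P * A)ᵀ = P * A

/-- `T` is a top-`r` singular value truncation of `M`: for some (thin) singular value decomposition
`M = U diag(s) Vᵀ` with `s` nonincreasing, `T` keeps exactly the first `r` singular values.
(`T` is unique if and only if there is no tie at the cut.) -/
def IsTruncation {m n : ℕ} (r : ℕ) (M T : Matrix (Fin m) (Fin n) ℝ) : Prop :=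
  ∃ (U : Matrix (Fin m) (Fin (min m n)) ℝ) (V : Matrix (Fin n) (Fin (min m n)) ℝ)
    (s : Fin (min m n) → ℝ),
    Uᵀ * U = 1 ∧ Vᵀ * V = 1 ∧ Antitone s ∧ (∀ i, 0 ≤ s i) ∧
    M = U * Matrix.diagonal s * Vᵀ ∧
    T = U * Matrix.diagonal (fun i : Fin (min m n) => if (i : ℕ) < r then s i else 0) * Vᵀ

/-! ### Data -/

/-- The matrix whose columns are the given vectors. -/
def colMatrix {d n : ℕ} (x : Fin n → EuclideanSpace ℝ (Fin d)) : Matrix (Fin d) (Fin n) ℝ :=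
  Matrix.of fun i j => x j i

/-- The population covariance (second moment matrix) `E[x xᵀ]` for `x` with law `μ`. -/
def popCov {d : ℕ} (μ : Measure (EuclideanSpace ℝ (Fin d))) : Matrix (Fin d) (Fin d) ℝ :=
  Matrix.of fun i j => ∫ x, x i * x j ∂μ

/-- The empirical covariance `(1/n) X Xᵀ`. -/
def empCov {d n : ℕ} (X : Matrix (Fin d) (Fin n) ℝ) : Matrix (Fin d) (Fin d) ℝ :=
  (1 / (n : ℝ)) • (X * Xᵀ)

/-- The law of a sample `(x, y)` with `y = A x + ε`, where `x` has law `μ` and the noise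
`ε ∼ N(0, S)` is independent of `x`. -/
def sampleLaw {dx dy : ℕ} (A : Matrix (Fin dy) (Fin dx) ℝ)
    (μ : Measure (EuclideanSpace ℝ (Fin dx))) (S : Matrix (Fin dy) (Fin dy) ℝ) :
    Measure (EuclideanSpace ℝ (Fin dx) × EuclideanSpace ℝ (Fin dy)) :=
  (μ.prod (multivariateGaussian 0 S)).map
    (fun p => (p.1, Matrix.toEuclideanLin A p.1 + p.2))

/-- The population risk `R(A) = E ‖A x - y‖²` of a fixed matrix `A`, for a fresh pair `(x, y)` with
law `Q`. -/
def risk {dx dy : ℕ} (Q : Measure (EuclideanSpace ℝ (Fin dx) × EuclideanSpace ℝ (Fin dy)))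
    (A : Matrix (Fin dy) (Fin dx) ℝ) : ℝ≥0∞ :=
  ∫⁻ p, ENNReal.ofReal (‖Matrix.toEuclideanLin A p.1 - p.2‖ ^ 2) ∂Q

/-! ### The LoRA estimator -/

/-- `A` minimizes `‖A X - Y‖_F²` subject to `rank (A - A₀) ≤ r`. -/
def IsLoRAMinimizer {dx dy n : ℕ} (r : ℕ) (A₀ : Matrix (Fin dy) (Fin dx) ℝ)
    (X : Matrix (Fin dx) (Fin n) ℝ) (Y : Matrix (Fin dy) (Fin n) ℝ)
    (A : Matrix (Fin dy) (Fin dx) ℝ) : Prop :=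
  (A - A₀).rank ≤ r ∧
    ∀ B : Matrix (Fin dy) (Fin dx) ℝ, (B - A₀).rank ≤ r →
      frobSq (A * X - Y) ≤ frobSq (B * X - Y)

/-- `A` is a minimizer of the LoRA problem that is closest to `A₀` among all minimizers. -/
def IsMinNormLoRA {dx dy n : ℕ} (r : ℕ) (A₀ : Matrix (Fin dy) (Fin dx) ℝ)
    (X : Matrix (Fin dx) (Fin n) ℝ) (Y : Matrix (Fin dy) (Fin n) ℝ)
    (A : Matrix (Fin dy) (Fin dx) ℝ) : Prop :=
  IsLoRAMinimizer r A₀ X Y A ∧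
    ∀ B : Matrix (Fin dy) (Fin dx) ℝ, IsLoRAMinimizer r A₀ X Y B →
      frobSq (A - A₀) ≤ frobSq (B - A₀)

/-- `A` is given by the closed form `A = A₀ + [Δ_FFT Σ̂^{1/2}]_r (Σ̂^{1/2})†` with
`Δ_FFT = (Y - A₀ X) X†` and `Σ̂ = (1/n) X Xᵀ`. Here `R` is the positive semidefinite square root of
`Σ̂`, and `Xd`, `Rd` are the Moore-Penrose inverses of `X`, `R`. -/
def IsClosedFormLoRA {dx dy n : ℕ} (r : ℕ) (A₀ : Matrix (Fin dy) (Fin dx) ℝ)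
    (X : Matrix (Fin dx) (Fin n) ℝ) (Y : Matrix (Fin dy) (Fin n) ℝ)
    (A : Matrix (Fin dy) (Fin dx) ℝ) : Prop :=
  ∃ (R Rd : Matrix (Fin dx) (Fin dx) ℝ) (Xd : Matrix (Fin n) (Fin dx) ℝ)
    (T : Matrix (Fin dy) (Fin dx) ℝ),
    R.PosSemidef ∧ R * R = empCov X ∧ IsMoorePenroseInverse R Rd ∧ IsMoorePenroseInverse X Xd ∧
    IsTruncation r ((Y - A₀ * X) * Xd * R) T ∧ A = A₀ + T * Rd

/-- The LoRA solution: either of its two descriptions. They agree whenever the truncation is unique;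
allowing both makes the results about LoRA solutions apply to each of them. -/
def IsLoRASolution {dx dy n : ℕ} (r : ℕ) (A₀ : Matrix (Fin dy) (Fin dx) ℝ)
    (X : Matrix (Fin dx) (Fin n) ℝ) (Y : Matrix (Fin dy) (Fin n) ℝ)
    (A : Matrix (Fin dy) (Fin dx) ℝ) : Prop :=
  IsMinNormLoRA r A₀ X Y A ∨ IsClosedFormLoRA r A₀ X Y A

end

end LoRA

/-! ### Low-rank least squares: deterministic error bounds -/

namespace LoRA

/-! Write `N = Y - Astar * X` for the noise and `E = Ahat - Astar` for the error. Since `Astar - A₀`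
has rank at most `r`, its singular values beyond the `r`-th vanish, which kills both bias terms, and
`E` has rank at most `2r`. The noise then acts only through the constant `c = sup (uᵀN · wᵀX)² /
(|u|² |wᵀX|²)`, which measures the operator norm of `N` restricted to the row space of `X`.

For fixed data, `‖E X‖_F² ≤ 8 r c` for both kinds of LoRA solution. For a minimizer, comparison with
the feasible `Astar` gives `‖E X‖² ≤ 2⟨N, E X⟩`, and Cauchy–Schwarz over `2r` rank-one terms
finishes. For the closed form, the truncated matrix is a rank-`r` matrix plus a perturbation of
squared operator norm at most `c / n`, and Weyl's inequality finishes (`frobSq_truncation_sub_le`).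

Replacing the empirical covariance by the population one costs the factor `lambdaMax (Σ * Σ̂⁻¹)`, so
the excess risk `tr (E Σ Eᵀ)` is at most `(8 r / n) * lambdaMax (Σ * Σ̂⁻¹) * c`.

For every fixed `X` the mean of `c` is at most `64 * lambdaMax S * (dx + dy + 2)`: the row space of
`X` has dimension at most `dx`, whatever `n` is, and `lintegral_iSup_sq_le_of_gaussian` bounds the
supremum of a Gaussian bilinear form. Instead of a net, that bound uses the convexity of `exp (t
b²)` in each argument, which dominates the supremum by an integral over balls. As this bound does
not depend on `X`, independence of features and noise lets the two factors be integrated in turn.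

Suprema over a dense sequence (`noiseSup`, `covRatio`) stand in for `c` and for the eigenvalue, so
that Tonelli's theorem applies to functions that are visibly measurable. -/

lemma frobSq_eq_trace {m n : ℕ} (A : Matrix (Fin m) (Fin n) ℝ) :
    frobSq A = (A * Aᵀ).trace := by
  simp [frobSq, Matrix.trace, Matrix.mul_apply, sq]

lemma frobSq_nonneg {m n : ℕ} (A : Matrix (Fin m) (Fin n) ℝ) : 0 ≤ frobSq A :=
  Finset.sum_nonneg fun _ _ => Finset.sum_nonneg fun _ _ => sq_nonneg _

lemma frobSq_eq_sum_row {m n : ℕ} (A : Matrix (Fin m) (Fin n) ℝ) :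
    frobSq A = ∑ i, A i ⬝ᵥ A i := by
  simp [frobSq, dotProduct, sq]

lemma frobSq_transpose {m n : ℕ} (A : Matrix (Fin m) (Fin n) ℝ) : frobSq Aᵀ = frobSq A := by
  rw [frobSq, frobSq, Finset.sum_comm]; rfl

lemma frobSq_isometry_mul {m l n : ℕ} {U : Matrix (Fin m) (Fin l) ℝ} (hU : Uᵀ * U = 1)
    (B : Matrix (Fin l) (Fin n) ℝ) : frobSq (U * B) = frobSq B := by
  rw [frobSq_eq_trace, frobSq_eq_trace, Matrix.transpose_mul, Matrix.mul_assoc, Matrix.trace_mul_comm,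
    Matrix.mul_assoc, Matrix.mul_assoc, hU, Matrix.mul_one]

lemma dotProduct_isometry_mulVec {m l : ℕ} {U : Matrix (Fin m) (Fin l) ℝ} (hU : Uᵀ * U = 1)
    (a b : Fin l → ℝ) : (U *ᵥ a) ⬝ᵥ (U *ᵥ b) = a ⬝ᵥ b := by
  rw [Matrix.dotProduct_mulVec, Matrix.vecMul_mulVec, ← Matrix.mulVec_transpose, Matrix.transpose_mul,
    Matrix.transpose_transpose, hU, Matrix.one_mulVec]

/-- A matrix of rank at most `k` is fixed by the projection onto the span of at most `k`
orthonormal vectors. -/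
lemma exists_isometry_mul_eq_self {m n k : ℕ} (A : Matrix (Fin m) (Fin n) ℝ) (hA : A.rank ≤ k) :
    ∃ (l : ℕ) (U : Matrix (Fin m) (Fin l) ℝ), l ≤ k ∧ Uᵀ * U = 1 ∧ U * (Uᵀ * A) = A := by
  let K : Submodule ℝ (EuclideanSpace ℝ (Fin m)) := LinearMap.range (Matrix.toEuclideanLin A)
  let b := stdOrthonormalBasis ℝ K
  have hl : Module.finrank ℝ K ≤ k := by
    refine le_of_eq_of_le (Matrix.rank_eq_finrank_range_toLin A (PiLp.basisFun 2 ℝ _)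
      (PiLp.basisFun 2 ℝ _)).symm ?_
    exact hA
  refine ⟨Module.finrank ℝ K, Matrix.of fun i k => (b k : EuclideanSpace ℝ (Fin m)) i, hl, ?_, ?_⟩
  · ext i j
    have := orthonormal_iff_ite.1 b.orthonormal i j
    simp only [Submodule.coe_inner, PiLp.inner_apply, RCLike.inner_apply, conj_trivial] at this
    simp only [Matrix.mul_apply, Matrix.transpose_apply, Matrix.of_apply, Matrix.one_apply, ← this]
    exact Finset.sum_congr rfl fun _ _ => mul_comm _ _
  · ext i j
    let a : K := ⟨Matrix.toEuclideanLin A (EuclideanSpace.single j 1), LinearMap.mem_range_self _ _⟩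
    have ha : ∀ i, (a : EuclideanSpace ℝ (Fin m)) i = A i j := fun i => by
      simp [a, Matrix.toLpLin_apply]
    have := congrArg (fun z : K => (z : EuclideanSpace ℝ (Fin m)) i) (b.sum_repr' a)
    simp only [ha, Submodule.coe_sum, Submodule.coe_smul, WithLp.ofLp_sum, Finset.sum_apply,
      PiLp.smul_apply, smul_eq_mul, Submodule.coe_inner, PiLp.inner_apply, RCLike.inner_apply,
      conj_trivial] at this
    rw [← this]
    simp only [Matrix.mul_apply, Matrix.transpose_apply, Matrix.of_apply]
    refine Finset.sum_congr rfl fun k _ => ?_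
    rw [mul_comm]
    congr 1
    exact Finset.sum_congr rfl fun _ _ => mul_comm _ _

/-- `c` bounds the squared bilinear form `(uᵀ N) · (wᵀ X)` relative to `|u|² |wᵀ X|²`. -/
def NoiseBound {dx dy n : ℕ} (X : Matrix (Fin dx) (Fin n) ℝ) (N : Matrix (Fin dy) (Fin n) ℝ)
    (c : ℝ) : Prop :=
  ∀ u w, ((u ᵥ* N) ⬝ᵥ (w ᵥ* X)) ^ 2 ≤ c * (u ⬝ᵥ u) * ((w ᵥ* X) ⬝ᵥ (w ᵥ* X))

/-- Factoring `E = U W` through an orthonormal basis of its range turns the inner product `⟨N, E X⟩`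
into at most `k` terms of the form controlled by `NoiseBound`; Cauchy–Schwarz over these terms costs
the factor `k`. -/
lemma sq_trace_mul_le {dx dy n k : ℕ} {X : Matrix (Fin dx) (Fin n) ℝ}
    {N : Matrix (Fin dy) (Fin n) ℝ} {c : ℝ} (_hc : 0 ≤ c) (h : NoiseBound X N c)
    {E : Matrix (Fin dy) (Fin dx) ℝ} (hE : E.rank ≤ k) :
    (N * (E * X)ᵀ).trace ^ 2 ≤ k * c * frobSq (E * X) := by
  obtain ⟨l, U, hl, hU, hUE⟩ := exists_isometry_mul_eq_self E hE
  set W := Uᵀ * E with hW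
  have h1 : frobSq (E * X) = ∑ i, (W i ᵥ* X) ⬝ᵥ (W i ᵥ* X) := by
    rw [← hUE, Matrix.mul_assoc, frobSq_isometry_mul hU, frobSq_eq_sum_row]; rfl
  have h2 : (N * (E * X)ᵀ).trace = ∑ i, (Uᵀ i ᵥ* N) ⬝ᵥ (W i ᵥ* X) := by
    rw [← hUE, Matrix.mul_assoc, Matrix.transpose_mul, ← Matrix.mul_assoc, Matrix.trace_mul_comm,
      ← Matrix.mul_assoc]
    rfl
  have h3 : ∀ i, Uᵀ i ⬝ᵥ Uᵀ i = 1 := fun i => by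
    have := congrFun (congrFun hU i) i
    rwa [Matrix.one_apply_eq] at this
  rw [h1, h2]
  calc _ ≤ (l : ℝ) * ∑ i, ((Uᵀ i ᵥ* N) ⬝ᵥ (W i ᵥ* X)) ^ 2 := by
        simpa using sq_sum_le_card_mul_sum_sq (s := (Finset.univ : Finset (Fin l)))
          (f := fun i => (Uᵀ i ᵥ* N) ⬝ᵥ (W i ᵥ* X))
    _ ≤ (k : ℝ) * ∑ i, c * ((W i ᵥ* X) ⬝ᵥ (W i ᵥ* X)) := by
        gcongr with i
        simpa [h3] using h (Uᵀ i) (W i)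
    _ = _ := by rw [← Finset.mul_sum, mul_assoc]

/-- The basic inequality for a least squares estimator whose error has rank at most `2 r`. -/
lemma frobSq_le_of_frobSq_sub_le {dx dy n r : ℕ} {X : Matrix (Fin dx) (Fin n) ℝ}
    {N : Matrix (Fin dy) (Fin n) ℝ} {c : ℝ} (hc : 0 ≤ c) (h : NoiseBound X N c)
    {E : Matrix (Fin dy) (Fin dx) ℝ} (hE : E.rank ≤ 2 * r)
    (hle : frobSq (E * X - N) ≤ frobSq N) : frobSq (E * X) ≤ 8 * r * c := by
  have h1 := sq_trace_mul_le hc h hE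
  have h2 : frobSq (E * X - N) = frobSq (E * X) - 2 * (N * (E * X)ᵀ).trace + frobSq N := by
    have h3 : ((E * X) * Nᵀ).trace = (N * (E * X)ᵀ).trace := by
      rw [← Matrix.trace_transpose, Matrix.transpose_mul, Matrix.transpose_transpose]
    simp only [frobSq_eq_trace, Matrix.transpose_sub, Matrix.sub_mul, Matrix.mul_sub,
      Matrix.trace_sub, h3]
    ring
  have h0 := frobSq_nonneg (E * X)
  push_cast at h1
  rw [h2] at hle
  -- With `a = ‖E X‖²` and `τ = ⟨N, E X⟩`, one has `a ≤ 2τ` and `τ² ≤ 2rc a`, hence `a² ≤ 8rc a`;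
  -- divide by `a` unless it is zero.
  rcases h0.eq_or_lt with h0 | h0
  · rw [← h0]; positivity
  · refine le_of_mul_le_mul_right ?_ h0
    nlinarith

lemma rank_sub_le {m n : ℕ} (A B : Matrix (Fin m) (Fin n) ℝ) :
    (A - B).rank ≤ A.rank + B.rank := by
  have h : LinearMap.range (A - B).mulVecLin ≤
      LinearMap.range A.mulVecLin ⊔ LinearMap.range B.mulVecLin := by
    rintro _ ⟨v, rfl⟩
    rw [Matrix.mulVecLin_apply, Matrix.sub_mulVec]
    exact Submodule.sub_mem_sup (LinearMap.mem_range_self A.mulVecLin v)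
      (LinearMap.mem_range_self B.mulVecLin v)
  exact (Submodule.finrank_mono h).trans (Submodule.finrank_add_le_finrank_add_finrank _ _)

/-- `Astar` is itself feasible, so the minimizer fits the data at least as well, and both differ
from `A₀` by rank at most `r`. -/
lemma frobSq_mul_le_of_isLoRAMinimizer {dx dy n r : ℕ} {X : Matrix (Fin dx) (Fin n) ℝ}
    {Y : Matrix (Fin dy) (Fin n) ℝ} {A Astar A₀ : Matrix (Fin dy) (Fin dx) ℝ} {c : ℝ} (hc : 0 ≤ c)
    (h : NoiseBound X (Y - Astar * X) c) (hr : (Astar - A₀).rank ≤ r)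
    (hA : IsLoRAMinimizer r A₀ X Y A) : frobSq ((A - Astar) * X) ≤ 8 * r * c := by
  have h1 : (A - Astar).rank ≤ 2 * r := by
    rw [← sub_sub_sub_cancel_right A Astar A₀, two_mul]
    exact (rank_sub_le _ _).trans (add_le_add hA.1 hr)
  refine frobSq_le_of_frobSq_sub_le hc h h1 ?_
  have h2 := hA.2 Astar hr
  rw [show (A - Astar) * X - (Y - Astar * X) = A * X - Y by rw [Matrix.sub_mul]; abel]
  refine h2.trans_eq ?_
  simp only [frobSq, Matrix.sub_apply]
  exact Finset.sum_congr rfl fun _ _ => Finset.sum_congr rfl fun _ _ => sub_sq_comm _ _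

/-! ### Truncated singular value decompositions and the closed form -/

lemma frobSq_le_of_mulVec_le {m n k : ℕ} {A : Matrix (Fin m) (Fin n) ℝ} {c : ℝ} (hc : 0 ≤ c)
    (hA : A.rank ≤ k) (h : ∀ v, (A *ᵥ v) ⬝ᵥ (A *ᵥ v) ≤ c * (v ⬝ᵥ v)) : frobSq A ≤ k * c := by
  rw [← Matrix.rank_transpose] at hA
  obtain ⟨l, U, hl, hU, hUA⟩ := exists_isometry_mul_eq_self Aᵀ hA
  rw [← frobSq_transpose, ← hUA, frobSq_isometry_mul hU, frobSq_eq_sum_row]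
  have h3 : ∀ i, Uᵀ i ⬝ᵥ Uᵀ i = 1 := fun i => by
    have := congrFun (congrFun hU i) i
    rwa [Matrix.one_apply_eq] at this
  calc _ ≤ ∑ i : Fin l, c := by
        gcongr with i
        have := h (Uᵀ i)
        rw [← Matrix.vecMul_transpose, h3, mul_one] at this
        exact this
    _ ≤ k * c := by simp; gcongr

lemma exists_mulVec_eq_zero_of_rank_lt {m n : ℕ} (A : Matrix (Fin m) (Fin n) ℝ) (h : A.rank < n) :
    ∃ b, b ≠ 0 ∧ A *ᵥ b = 0 := by
  have h1 := LinearMap.finrank_range_add_finrank_ker A.mulVecLin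
  rw [Module.finrank_fin_fun] at h1
  have h2 : A.rank = Module.finrank ℝ (LinearMap.range A.mulVecLin) := rfl
  have h3 : 0 < Module.finrank ℝ (LinearMap.ker A.mulVecLin) := by omega
  obtain ⟨b, hb⟩ := (Module.finrank_pos_iff_exists_ne_zero).1 h3
  exact ⟨b, by simpa using hb, b.2⟩

lemma transpose_mulVec_le {m l : ℕ} {V : Matrix (Fin m) (Fin l) ℝ} (hV : Vᵀ * V = 1)
    (v : Fin m → ℝ) : (Vᵀ *ᵥ v) ⬝ᵥ (Vᵀ *ᵥ v) ≤ v ⬝ᵥ v := by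
  have h0 : 0 ≤ (v - V *ᵥ (Vᵀ *ᵥ v)) ⬝ᵥ (v - V *ᵥ (Vᵀ *ᵥ v)) :=
    Finset.sum_nonneg fun _ _ => mul_self_nonneg _
  have h1 : v ⬝ᵥ (V *ᵥ (Vᵀ *ᵥ v)) = (Vᵀ *ᵥ v) ⬝ᵥ (Vᵀ *ᵥ v) := by
    rw [Matrix.dotProduct_mulVec, Matrix.mulVec_transpose]
  rw [sub_dotProduct, dotProduct_sub, dotProduct_sub, dotProduct_isometry_mulVec hV,
    dotProduct_comm (V *ᵥ _) v, h1] at h0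
  linarith

/-- Truncating a perturbation `B + W` of a matrix `B` of rank at most `r` gives back `B` up to an
error controlled by the operator norm of `W`. -/
lemma frobSq_truncation_sub_le {m n r : ℕ} {M T B : Matrix (Fin m) (Fin n) ℝ} {c : ℝ} (hc : 0 ≤ c)
    (hr : r < min m n) (hT : IsTruncation r M T) (hB : B.rank ≤ r)
    (hW : ∀ v, ((M - B) *ᵥ v) ⬝ᵥ ((M - B) *ᵥ v) ≤ c * (v ⬝ᵥ v)) :
    frobSq (T - B) ≤ 8 * r * c := by
  obtain ⟨U, V, s, hU, hV, hs, hs0, hM, hTd⟩ := hT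
  -- Weyl's inequality for the `(r+1)`-st singular value (index `r` from zero). `J` embeds the first
  -- `r + 1` coordinates; some nonzero combination of the first `r + 1` right singular vectors is
  -- killed by `B`, and on it `M` agrees with `M - B` while stretching by at least `s r`.
  have hsr : s ⟨r, hr⟩ ^ 2 ≤ c := by
    let J : Matrix (Fin (min m n)) (Fin (r + 1)) ℝ :=
      Matrix.of fun i j => if (i : ℕ) = j then 1 else 0
    have hJ : Jᵀ * J = 1 := by
      ext i j
      simp only [Matrix.mul_apply, Matrix.transpose_apply, J, Matrix.of_apply, Matrix.one_apply]
      rw [Finset.sum_eq_single (⟨i, by omega⟩ : Fin (min m n))]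
      · simp [Fin.ext_iff]
      · intro k _ hk
        rw [if_neg (fun h => hk (Fin.ext h)), zero_mul]
      · simp
    obtain ⟨b, hb0, hb⟩ := exists_mulVec_eq_zero_of_rank_lt (B * (V * J))
      (((Matrix.rank_mul_le_left _ _).trans hB).trans_lt (Nat.lt_succ_self r))
    have hbpos : 0 < b ⬝ᵥ b := by
      refine lt_of_le_of_ne (Finset.sum_nonneg fun _ _ => mul_self_nonneg _) fun h => hb0 ?_
      exact dotProduct_self_eq_zero.1 h.symm
    have hVJ : (V * J)ᵀ * (V * J) = 1 := by
      rw [Matrix.transpose_mul, Matrix.mul_assoc, ← Matrix.mul_assoc Vᵀ, hV, Matrix.one_mul, hJ]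
    have h1 := hW ((V * J) *ᵥ b)
    rw [Matrix.sub_mulVec, Matrix.mulVec_mulVec b B, hb, sub_zero,
      dotProduct_isometry_mulVec hVJ] at h1
    have h2 : M *ᵥ ((V * J) *ᵥ b) = U *ᵥ (Matrix.diagonal s *ᵥ (J *ᵥ b)) := by
      rw [hM, Matrix.mulVec_mulVec, Matrix.mulVec_mulVec, Matrix.mulVec_mulVec]
      congr 1
      rw [Matrix.mul_assoc, ← Matrix.mul_assoc Vᵀ, hV, Matrix.one_mul]
    rw [h2, dotProduct_isometry_mulVec hU] at h1
    have h3 : s ⟨r, hr⟩ ^ 2 * (b ⬝ᵥ b) ≤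
        (Matrix.diagonal s *ᵥ (J *ᵥ b)) ⬝ᵥ (Matrix.diagonal s *ᵥ (J *ᵥ b)) := by
      rw [← dotProduct_isometry_mulVec hJ]
      simp only [dotProduct, Matrix.mulVec_diagonal, Finset.mul_sum]
      refine Finset.sum_le_sum fun i _ => ?_
      by_cases hi : (i : ℕ) ≤ r
      · have h4 : s ⟨r, hr⟩ ≤ s i := hs hi
        have h5 := pow_le_pow_left₀ (hs0 _) h4 2
        nlinarith [mul_self_nonneg ((J *ᵥ b) i)]
      · have : (J *ᵥ b) i = 0 := by
          rw [Matrix.mulVec, dotProduct]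
          refine Finset.sum_eq_zero fun j _ => ?_
          simp only [J, Matrix.of_apply]
          rw [if_neg (by omega), zero_mul]
        simp [this]
    exact le_of_mul_le_mul_right (h3.trans h1) hbpos
  have hMT : ∀ v, ((T - M) *ᵥ v) ⬝ᵥ ((T - M) *ᵥ v) ≤ c * (v ⬝ᵥ v) := fun v => by
    have h1 : T - M = U * Matrix.diagonal
        (fun i : Fin (min m n) => if (i : ℕ) < r then 0 else - s i) * Vᵀ := by
      rw [hTd, hM, ← Matrix.sub_mul, ← Matrix.mul_sub, Matrix.diagonal_sub]
      congr 3
      ext i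
      split_ifs <;> simp
    rw [h1, ← Matrix.mulVec_mulVec, ← Matrix.mulVec_mulVec, dotProduct_isometry_mulVec hU]
    refine le_trans ?_ (mul_le_mul_of_nonneg_left (transpose_mulVec_le hV v) hc)
    simp only [dotProduct, Matrix.mulVec_diagonal, Finset.mul_sum]
    refine Finset.sum_le_sum fun i _ => ?_
    split_ifs with hi
    · simpa using mul_nonneg hc (mul_self_nonneg _)
    · have h4 : s i ≤ s ⟨r, hr⟩ := hs (not_lt.1 hi)
      have h5 := (pow_le_pow_left₀ (hs0 _) h4 2).trans hsr
      nlinarith [mul_self_nonneg ((Vᵀ *ᵥ v) i)]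
  have hTr : T.rank ≤ r := by
    rw [hTd]
    refine (Matrix.rank_mul_le_left _ _).trans ((Matrix.rank_mul_le_right _ _).trans ?_)
    rw [Matrix.rank_diagonal]
    calc _ ≤ Fintype.card (Fin r) := by
          refine Fintype.card_le_of_injective (fun i => ⟨i.1, ?_⟩) ?_
          · by_contra h
            exact i.2 (if_neg h)
          · intro i j hij
            simpa [Fin.ext_iff, Subtype.ext_iff] using hij
      _ = r := Fintype.card_fin r
  have hrk : (T - B).rank ≤ 2 * r := (rank_sub_le _ _).trans (by omega)
  -- Both `T - M` and `M - B` have squared operator norm at most `c`, so their sum has at most `4c`;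
  -- rank `2r` then gives `8rc`.
  have := frobSq_le_of_mulVec_le (c := 4 * c) (by positivity) hrk fun v => by
    have h1 : (T - B) *ᵥ v = (T - M) *ᵥ v + (M - B) *ᵥ v := by
      rw [← Matrix.add_mulVec, sub_add_sub_cancel]
    have h2 : ∀ a b : Fin m → ℝ, (a + b) ⬝ᵥ (a + b) ≤ 2 * (a ⬝ᵥ a) + 2 * (b ⬝ᵥ b) := fun a b => by
      simp only [dotProduct, Finset.mul_sum, ← Finset.sum_add_distrib]
      refine Finset.sum_le_sum fun i _ => ?_
      simp only [Pi.add_apply]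
      nlinarith [sq_nonneg (a i - b i)]
    rw [h1]
    linarith [h2 ((T - M) *ᵥ v) ((M - B) *ᵥ v), hMT v, hW v]
  refine this.trans_eq ?_
  push_cast; ring

lemma frobSq_mul_eq_empCov {dx dy n : ℕ} (hn : 0 < n) (X : Matrix (Fin dx) (Fin n) ℝ)
    (E : Matrix (Fin dy) (Fin dx) ℝ) :
    frobSq (E * X) = n * (E * empCov X * Eᵀ).trace := by
  have : (n : ℝ) ≠ 0 := by positivity
  rw [frobSq_eq_trace, Matrix.transpose_mul, empCov, Matrix.mul_smul, Matrix.smul_mul,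
    Matrix.trace_smul, smul_eq_mul, ← mul_assoc, mul_one_div_cancel this, one_mul]
  simp only [Matrix.mul_assoc]

lemma dotProduct_empCov {dx n : ℕ} (X : Matrix (Fin dx) (Fin n) ℝ) (w : Fin dx → ℝ) :
    w ⬝ᵥ (empCov X *ᵥ w) = (1 / n) * ((w ᵥ* X) ⬝ᵥ (w ᵥ* X)) := by
  rw [empCov, Matrix.smul_mulVec, dotProduct_smul, smul_eq_mul, ← Matrix.mulVec_mulVec,
    Matrix.dotProduct_mulVec, Matrix.mulVec_transpose]

lemma frobSq_mul_le_of_isClosedFormLoRA {dx dy n r : ℕ} (hn : 0 < n) (hrd : r < min dx dy)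
    {X : Matrix (Fin dx) (Fin n) ℝ}
    {Y : Matrix (Fin dy) (Fin n) ℝ} {A Astar A₀ : Matrix (Fin dy) (Fin dx) ℝ} {c : ℝ} (hc : 0 ≤ c)
    (hX : IsUnit (empCov X))
    (h : NoiseBound X (Y - Astar * X) c) (hr : (Astar - A₀).rank ≤ r)
    (hA : IsClosedFormLoRA r A₀ X Y A) : frobSq ((A - Astar) * X) ≤ 8 * r * c := by
  obtain ⟨R, Rd, Xd, T, hR, hRR, hRd, hXd, hT, rfl⟩ := hA
  have hn' : (n : ℝ) ≠ 0 := by positivity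
  have hRu : IsUnit R := isUnit_of_mul_isUnit_left (hRR ▸ hX)
  have hRdet : IsUnit R.det := (Matrix.isUnit_iff_isUnit_det _).1 hRu
  have hRt : Rᵀ = R := by simpa using hR.isHermitian.eq
  have hRdR : Rd * R = 1 := by
    have := hRd.mul_mul_self
    rw [Matrix.mul_assoc] at this
    exact hRu.mul_left_cancel (by rw [this, mul_one])
  have hXX : X * Xᵀ = (n : ℝ) • (R * R) := by
    rw [hRR, empCov, smul_smul, mul_one_div_cancel hn', one_smul]
  have hXXu : IsUnit (X * Xᵀ) := by
    rw [hXX, hRR]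
    exact hX.smul (Units.mk0 (n : ℝ) hn')
  have hXXd : X * Xd = 1 := by
    have h1 : X * Xd * (X * Xᵀ) = 1 * (X * Xᵀ) := by
      rw [← Matrix.mul_assoc, hXd.mul_mul_self, Matrix.one_mul]
    exact hXXu.mul_right_cancel h1
  -- Here `Xd = Xᵀ (X Xᵀ)⁻¹`, because `X` has full row rank, and `X Xᵀ = n R²`.
  have hXdR : Xd * R = (1 / n : ℝ) • (Xᵀ * R⁻¹) := by
    have h1 : Xd = Xᵀ * (Xdᵀ * Xd) := by
      rw [← Matrix.mul_assoc, ← Matrix.transpose_mul, hXd.symm_right, hXd.self_mul_mul]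
    have h2 : (X * Xᵀ) * (Xdᵀ * Xd) = 1 := by
      rw [Matrix.mul_assoc, ← h1, hXXd]
    rw [hXX, Matrix.smul_mul] at h2
    have h3 : R * (R * (Xdᵀ * Xd) * R) = R * ((1 / n : ℝ) • 1) := by
      rw [← Matrix.mul_assoc, ← Matrix.mul_assoc, Matrix.mul_smul, Matrix.mul_one]
      have : R * R * (Xdᵀ * Xd) = (1 / n : ℝ) • 1 := by
        rw [← h2, smul_smul, one_div_mul_cancel hn', one_smul]
      rw [this, Matrix.smul_mul, Matrix.one_mul]
    have h4 := hRu.mul_left_cancel h3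
    rw [Matrix.mul_assoc] at h4
    have h5 : Xdᵀ * Xd * R = (1 / n : ℝ) • R⁻¹ := by
      refine hRu.mul_left_cancel ?_
      rw [h4, Matrix.mul_smul, Matrix.mul_nonsing_inv _ hRdet]
    rw [h1, Matrix.mul_assoc, h5, Matrix.mul_smul]
  set D := Astar - A₀ with hD
  set N := Y - Astar * X with hN
  have hM : (Y - A₀ * X) * Xd * R - D * R = (1 / n : ℝ) • (N * Xᵀ * R⁻¹) := by
    have h1 : Y - A₀ * X = D * X + N := by rw [hD, hN, Matrix.sub_mul]; abel
    rw [h1, Matrix.add_mul, Matrix.mul_assoc D, hXXd, Matrix.mul_one, Matrix.add_mul,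
      add_sub_cancel_left, Matrix.mul_assoc, hXdR, Matrix.mul_smul, Matrix.mul_assoc]
  -- The truncated matrix is `D R`, of rank at most `r`, plus `(1/n) N Xᵀ R⁻¹`. For `v = R w` and `z
  -- = N Xᵀ w`, the noise bound at `u = z` reads `|z|⁴ ≤ c |z|² n |v|²`, so the perturbation has
  -- squared operator norm at most `c / n`.
  have key := frobSq_truncation_sub_le (B := D * R) (c := c / n) (by positivity)
    (by rwa [min_comm]) hT ((Matrix.rank_mul_le_left _ _).trans hr) fun v => by
      rw [hM]
      set w := R⁻¹ *ᵥ v with hw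
      have hv : v = R *ᵥ w := by
        rw [hw, Matrix.mulVec_mulVec, Matrix.mul_nonsing_inv _ hRdet, Matrix.one_mulVec]
      set z := N *ᵥ (w ᵥ* X) with hz
      have h1 : ((1 / n : ℝ) • (N * Xᵀ * R⁻¹)) *ᵥ v = (1 / n : ℝ) • z := by
        rw [Matrix.smul_mulVec, ← Matrix.mulVec_mulVec, ← Matrix.mulVec_mulVec,
          Matrix.mulVec_transpose]
      have h2 : (w ᵥ* X) ⬝ᵥ (w ᵥ* X) = n * (v ⬝ᵥ v) := by
        have := dotProduct_empCov X w
        rw [← hRR, ← Matrix.mulVec_mulVec, ← hv, Matrix.dotProduct_mulVec,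
          ← Matrix.mulVec_transpose, hRt, ← hv] at this
        rw [this, ← mul_assoc, mul_one_div_cancel hn', one_mul]
      have h3 := h z w
      rw [← Matrix.dotProduct_mulVec, ← hz, h2] at h3
      have h4 : 0 ≤ z ⬝ᵥ z := Finset.sum_nonneg fun _ _ => mul_self_nonneg _
      have h5 : 0 ≤ v ⬝ᵥ v := Finset.sum_nonneg fun _ _ => mul_self_nonneg _
      have h6 : z ⬝ᵥ z ≤ c * (n * (v ⬝ᵥ v)) := by
        rcases h4.eq_or_lt with h0 | h0
        · rw [← h0]; positivity
        · refine le_of_mul_le_mul_right ?_ h0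
          nlinarith
      rw [h1, smul_dotProduct, dotProduct_smul, smul_eq_mul, smul_eq_mul]
      calc 1 / (n : ℝ) * (1 / n * (z ⬝ᵥ z)) ≤ 1 / (n : ℝ) * (1 / n * (c * (n * (v ⬝ᵥ v)))) := by
            gcongr
        _ = c / n * (v ⬝ᵥ v) := by field_simp
  have hE : (A₀ + T * Rd - Astar) * R = T - D * R := by
    rw [show A₀ + T * Rd - Astar = T * Rd - D by rw [hD]; abel, Matrix.sub_mul, Matrix.mul_assoc,
      hRdR, Matrix.mul_one]
  rw [← hE, frobSq_eq_trace, Matrix.transpose_mul, hRt, Matrix.mul_assoc, ← Matrix.mul_assoc R,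
    hRR, ← Matrix.mul_assoc] at key
  rw [frobSq_mul_eq_empCov hn]
  calc _ ≤ n * (8 * r * (c / n)) := by gcongr
    _ = _ := by field_simp

lemma frobSq_mul_le_of_isLoRASolution {dx dy n r : ℕ} (hn : 0 < n) (hrd : r < min dx dy)
    {X : Matrix (Fin dx) (Fin n) ℝ}
    {Y : Matrix (Fin dy) (Fin n) ℝ} {A Astar A₀ : Matrix (Fin dy) (Fin dx) ℝ} {c : ℝ} (hc : 0 ≤ c)
    (hX : IsUnit (empCov X))
    (h : NoiseBound X (Y - Astar * X) c) (hr : (Astar - A₀).rank ≤ r)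
    (hA : IsLoRASolution r A₀ X Y A) : frobSq ((A - Astar) * X) ≤ 8 * r * c := by
  rcases hA with hA | hA
  · exact frobSq_mul_le_of_isLoRAMinimizer hc h hr hA.1
  · exact frobSq_mul_le_of_isClosedFormLoRA hn hrd hc hX h hr hA

/-! ### Quadratic forms, largest eigenvalues, vanishing singular values -/

lemma trace_mul_mul_transpose {m n : ℕ} (E : Matrix (Fin m) (Fin n) ℝ)
    (S : Matrix (Fin n) (Fin n) ℝ) : (E * S * Eᵀ).trace = ∑ i, E i ⬝ᵥ (S *ᵥ E i) := by
  simp only [Matrix.trace, Matrix.diag]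
  refine Finset.sum_congr rfl fun i _ => ?_
  rw [Matrix.mul_assoc]
  rfl

lemma trace_mul_mul_transpose_le {m n : ℕ} (E : Matrix (Fin m) (Fin n) ℝ)
    {S S' : Matrix (Fin n) (Fin n) ℝ} {g : ℝ}
    (h : ∀ w, w ⬝ᵥ (S *ᵥ w) ≤ g * (w ⬝ᵥ (S' *ᵥ w))) :
    (E * S * Eᵀ).trace ≤ g * (E * S' * Eᵀ).trace := by
  rw [trace_mul_mul_transpose, trace_mul_mul_transpose, Finset.mul_sum]
  exact Finset.sum_le_sum fun i _ => h _

lemma dotProduct_mulVec_le_of_spectrum_le {d : ℕ} {S : Matrix (Fin d) (Fin d) ℝ}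
    (hS : S.IsHermitian) {g : ℝ} (hg : ∀ x ∈ spectrum ℝ S, x ≤ g) (u : Fin d → ℝ) :
    u ⬝ᵥ (S *ᵥ u) ≤ g * (u ⬝ᵥ u) := by
  have h1 : (algebraMap ℝ (Matrix (Fin d) (Fin d) ℝ) g - S).PosSemidef := by
    rw [Matrix.posSemidef_iff_isHermitian_and_spectrum_nonneg]
    refine ⟨Matrix.IsHermitian.sub ?_ hS, ?_⟩
    · rw [Algebra.algebraMap_eq_smul_one]
      simp [Matrix.IsHermitian]
    · rw [← spectrum.singleton_sub_eq]
      rintro x ⟨a, ha, b, hb, rfl⟩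
      rw [Set.mem_singleton_iff.1 ha]
      simpa using hg b hb
  have h2 := h1.dotProduct_mulVec_nonneg u
  rw [Algebra.algebraMap_eq_smul_one, Matrix.sub_mulVec, Matrix.smul_mulVec, Matrix.one_mulVec,
    dotProduct_sub, dotProduct_smul] at h2
  simpa using h2

lemma finite_spectrum {d : ℕ} (S : Matrix (Fin d) (Fin d) ℝ) : (spectrum ℝ S).Finite := by
  rw [← Matrix.spectrum_toLin']
  exact Module.End.finite_spectrum _

lemma dotProduct_mulVec_le_lambdaMax {d : ℕ} {S : Matrix (Fin d) (Fin d) ℝ}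
    (hS : S.IsHermitian) (u : Fin d → ℝ) :
    u ⬝ᵥ (S *ᵥ u) ≤ lambdaMax S * (u ⬝ᵥ u) :=
  dotProduct_mulVec_le_of_spectrum_le hS
    (fun _ hx => le_csSup (finite_spectrum S).bddAbove hx) u

-- Factor `S' = Bᵀ B`. The product `S S'⁻¹` is similar to the symmetric matrix `B⁻ᵀ S B⁻¹`, whose
-- Rayleigh quotient at `B w` is the ratio of the two forms at `w`.
open scoped MatrixOrder in
lemma dotProduct_mulVec_le_lambdaMax_mul_inv {d : ℕ} {S S' : Matrix (Fin d) (Fin d) ℝ}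
    (hS : S.PosSemidef) (hS' : S'.PosSemidef) (hu : IsUnit S') (w : Fin d → ℝ) :
    w ⬝ᵥ (S *ᵥ w) ≤ lambdaMax (S * S'⁻¹) * (w ⬝ᵥ (S' *ᵥ w)) := by
  obtain ⟨B, hB⟩ := CStarAlgebra.nonneg_iff_eq_star_mul_self.1 hS'.nonneg
  rw [Matrix.star_eq_conjTranspose, Matrix.conjTranspose_eq_transpose_of_trivial] at hB
  have hBu : IsUnit B := isUnit_of_mul_isUnit_right (hB ▸ hu)
  have hBd : IsUnit B.det := (Matrix.isUnit_iff_isUnit_det _).1 hBu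
  have hBtd : IsUnit Bᵀ.det := by rwa [Matrix.det_transpose]
  have hBt : IsUnit Bᵀ := (Matrix.isUnit_iff_isUnit_det _).2 hBtd
  have h1 : spectrum ℝ (S * S'⁻¹) = spectrum ℝ (Bᵀ⁻¹ * S * B⁻¹) := by
    have := spectrum.units_conjugate (R := ℝ) (a := Bᵀ⁻¹ * S * B⁻¹) (u := hBt.unit)
    rw [← this]
    congr 1
    rw [Matrix.coe_units_inv, hBt.unit_spec, hB, Matrix.mul_inv_rev]
    simp only [← Matrix.mul_assoc]
    rw [Matrix.mul_nonsing_inv _ hBtd, Matrix.one_mul]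
  have h2 : (Bᵀ⁻¹ * S * B⁻¹).PosSemidef := by
    have := hS.conjTranspose_mul_mul_same B⁻¹
    rwa [Matrix.conjTranspose_eq_transpose_of_trivial, Matrix.transpose_nonsing_inv] at this
  have h3 := dotProduct_mulVec_le_lambdaMax h2.isHermitian (B *ᵥ w)
  rw [lambdaMax, ← h1, ← lambdaMax] at h3
  have h4 : (B *ᵥ w) ⬝ᵥ (B *ᵥ w) = w ⬝ᵥ (S' *ᵥ w) := by
    rw [hB, ← Matrix.mulVec_mulVec, Matrix.dotProduct_mulVec w, Matrix.vecMul_transpose]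
  have h5 : (B *ᵥ w) ⬝ᵥ ((Bᵀ⁻¹ * S * B⁻¹) *ᵥ (B *ᵥ w)) = w ⬝ᵥ (S *ᵥ w) := by
    rw [Matrix.mulVec_mulVec, Matrix.mul_assoc, Matrix.nonsing_inv_mul _ hBd, Matrix.mul_one,
      ← Matrix.vecMul_transpose, ← Matrix.dotProduct_mulVec, Matrix.mulVec_mulVec,
      ← Matrix.mul_assoc, Matrix.mul_nonsing_inv _ hBtd, Matrix.one_mul]
  rwa [h4, h5] at h3

lemma posSemidef_empCov {dx n : ℕ} (X : Matrix (Fin dx) (Fin n) ℝ) : (empCov X).PosSemidef := by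
  have := (Matrix.posSemidef_self_mul_conjTranspose X).smul
    (show (0 : ℝ) ≤ 1 / (n : ℝ) by positivity)
  rwa [Matrix.conjTranspose_eq_transpose_of_trivial] at this

lemma sigma_eq_zero {m n : ℕ} (A : Matrix (Fin m) (Fin n) ℝ) {r i : ℕ} (hA : A.rank ≤ r)
    (hi : r + 1 ≤ i) : sigma A i = 0 := by
  -- `sigma` counts from one and `singularValues` from zero, so the index is `i - 1 ≥ r`.
  rw [sigma, LinearMap.singularValues_eq_zero_iff_le_finrank_range]
  have : Module.finrank ℝ (LinearMap.range (Matrix.toEuclideanLin A)) = A.rank :=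
    (Matrix.rank_eq_finrank_range_toLin A (PiLp.basisFun 2 ℝ _) (PiLp.basisFun 2 ℝ _)).symm
  omega

/-! ### Supremum of a Gaussian bilinear form -/

lemma lintegral_exp_sq_gaussianReal_le {v : NNReal} {t : ℝ} (ht : 4 * t * v ≤ 1) :
    ∫⁻ x, ENNReal.ofReal (Real.exp (t * x ^ 2)) ∂(gaussianReal 0 v) ≤ 2 := by
  rcases eq_or_ne v 0 with rfl | hv
  · rw [gaussianReal_zero_var, lintegral_dirac]
    simp
  · have hv0 : (0 : ℝ) < v := by positivity
    set β : ℝ := (2 * (v : ℝ))⁻¹ - t with hβ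
    have hβ0 : (4 * v : ℝ)⁻¹ ≤ β := by
      have h1 : t ≤ (4 * v : ℝ)⁻¹ := by
        rw [← one_div, le_div_iff₀ (by positivity)]; linarith
      have h2 : (2 * v : ℝ)⁻¹ = 2 * (4 * v : ℝ)⁻¹ := by field_simp; norm_num
      linarith
    have hβ1 : 0 < β := lt_of_lt_of_le (by positivity) hβ0
    rw [gaussianReal_of_var_ne_zero _ hv,
      lintegral_withDensity_eq_lintegral_mul _ (measurable_gaussianPDF 0 v) (by fun_prop)]
    have h1 : ∀ x : ℝ, (gaussianPDF 0 v * fun x => ENNReal.ofReal (Real.exp (t * x ^ 2))) x =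
        ENNReal.ofReal ((√(2 * Real.pi * v))⁻¹ * Real.exp (-β * x ^ 2)) := fun x => by
      rw [Pi.mul_apply, gaussianPDF, ← ENNReal.ofReal_mul (gaussianPDFReal_nonneg _ _ _),
        gaussianPDFReal, mul_assoc, ← Real.exp_add]
      congr 3
      rw [hβ]
      field_simp
      ring
    simp_rw [h1]
    rw [← ofReal_integral_eq_lintegral_ofReal ((integrable_exp_neg_mul_sq hβ1).const_mul _)
      (Filter.Eventually.of_forall fun x => by positivity), integral_const_mul, integral_gaussian]
    -- The exact value is `(1 - 2tv)^(-1/2)`, at most `√2` when `4tv ≤ 1`.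
    have h2 : (√(2 * Real.pi * v))⁻¹ * √(Real.pi / β) ≤ 2 := by
      rw [inv_mul_le_iff₀ (by positivity), Real.sqrt_le_left (by positivity), mul_pow,
        Real.sq_sqrt (by positivity), div_le_iff₀ hβ1]
      have : 1 ≤ 4 * v * β := by
        rwa [inv_le_iff_one_le_mul₀ (by positivity), mul_comm] at hβ0
      nlinarith [Real.pi_pos]
    simpa using ENNReal.ofReal_le_ofReal h2

/-- A mean value inequality: averaging the midpoint inequality over `h` in the unit ball bounds `f
a` by the mean of `f` over the ball of radius one around `a`, which lies in the ball of radius two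
around the origin. -/
lemma measure_ball_mul_le_setLIntegral {E : Type*} [NormedAddCommGroup E]
    [MeasurableSpace E] [BorelSpace E] (μ : Measure E) [μ.IsAddLeftInvariant] [μ.IsNegInvariant]
    {f : E → ℝ≥0∞} (hf : Measurable f) {a : E} (ha : ‖a‖ ≤ 1)
    (hmid : ∀ h, f a + f a ≤ f (a + h) + f (a - h)) :
    μ (Metric.ball 0 1) * f a ≤ ∫⁻ x in Metric.ball 0 2, f x ∂μ := by
  have hsub : Metric.ball a 1 ⊆ Metric.ball (0 : E) 2 := fun x hx => by
    rw [mem_ball_zero_iff]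
    rw [mem_ball_iff_norm] at hx
    calc ‖x‖ = ‖(x - a) + a‖ := by simp
      _ ≤ ‖x - a‖ + ‖a‖ := norm_add_le _ _
      _ < 2 := by linarith
  have hle : ∫⁻ x in Metric.ball a 1, f x ∂μ ≤ ∫⁻ x in Metric.ball 0 2, f x ∂μ :=
    lintegral_mono_set hsub
  refine le_trans ?_ hle
  have h1 : ∫⁻ h in Metric.ball 0 1, f (a + h) ∂μ = ∫⁻ x in Metric.ball a 1, f x ∂μ := by
    rw [← lintegral_indicator Metric.isOpen_ball.measurableSet,
      ← lintegral_indicator Metric.isOpen_ball.measurableSet,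
      ← lintegral_add_left_eq_self (Set.indicator (Metric.ball a 1) f) a]
    refine lintegral_congr fun h => ?_
    simp [Set.indicator, Metric.mem_ball, dist_eq_norm]
  have h2 : ∫⁻ h in Metric.ball 0 1, f (a - h) ∂μ = ∫⁻ x in Metric.ball a 1, f x ∂μ := by
    rw [← lintegral_indicator Metric.isOpen_ball.measurableSet,
      ← lintegral_indicator Metric.isOpen_ball.measurableSet,
      ← lintegral_sub_left_eq_self (Set.indicator (Metric.ball a 1) f) a]
    refine lintegral_congr fun h => ?_
    simp [Set.indicator, Metric.mem_ball, dist_eq_norm]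
  have h3 : 2 * (μ (Metric.ball 0 1) * f a) ≤ 2 * ∫⁻ x in Metric.ball a 1, f x ∂μ := by
    rw [two_mul (∫⁻ x in _, _ ∂μ)]
    nth_rw 1 [← h1]
    rw [← h2, ← lintegral_add_left (by fun_prop)]
    calc 2 * (μ (Metric.ball 0 1) * f a) = ∫⁻ _ in Metric.ball (0 : E) 1, (f a + f a) ∂μ := by
          rw [setLIntegral_const]; ring
      _ ≤ _ := lintegral_mono fun h => hmid h
  exact (ENNReal.mul_le_mul_iff_right (by simp) (by simp)).1 h3

lemma exp_sq_midpoint {t : ℝ} (ht : 0 ≤ t) (x h : ℝ) :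
    ENNReal.ofReal (Real.exp (t * x ^ 2)) + ENNReal.ofReal (Real.exp (t * x ^ 2)) ≤
      ENNReal.ofReal (Real.exp (t * (x + h) ^ 2)) + ENNReal.ofReal (Real.exp (t * (x - h) ^ 2)) := by
  rw [← ENNReal.ofReal_add (Real.exp_nonneg _) (Real.exp_nonneg _),
    ← ENNReal.ofReal_add (Real.exp_nonneg _) (Real.exp_nonneg _)]
  refine ENNReal.ofReal_le_ofReal ?_
  have h1 : t * (x + h) ^ 2 = t * x ^ 2 + t * h ^ 2 + 2 * t * x * h := by ring
  have h2 : t * (x - h) ^ 2 = t * x ^ 2 + t * h ^ 2 + -(2 * t * x * h) := by ring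
  rw [h1, h2, Real.exp_add _ (2 * t * x * h), Real.exp_add _ (-(2 * t * x * h))]
  have h3 : 1 ≤ Real.exp (t * h ^ 2) := Real.one_le_exp (by positivity)
  have h4 := Real.add_one_le_exp (2 * t * x * h)
  have h5 := Real.add_one_le_exp (-(2 * t * x * h))
  rw [Real.exp_add]
  have h6 : 0 < Real.exp (t * x ^ 2) := Real.exp_pos _
  calc _ ≤ Real.exp (t * x ^ 2) * Real.exp (t * h ^ 2) * 2 := by nlinarith
    _ ≤ Real.exp (t * x ^ 2) * Real.exp (t * h ^ 2) *
        (Real.exp (2 * t * x * h) + Real.exp (-(2 * t * x * h))) := by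
        gcongr; linarith
    _ = _ := by ring

/-- From `1 + a ≤ exp a` at `a = t (s - K)`. It turns an exponential moment into a bound on the
mean, with a free threshold `K`. -/
lemma le_add_exp_mul {t : ℝ} (ht : 0 < t) (K s : ℝ) :
    s ≤ K + t⁻¹ * Real.exp (-(t * K)) * Real.exp (t * s) := by
  have h := Real.add_one_le_exp (t * s - t * K)
  rw [mul_assoc, ← Real.exp_add, show -(t * K) + t * s = t * s - t * K by ring, ← sub_le_iff_le_add',
    ← div_eq_inv_mul, le_div_iff₀ ht]
  linarith

section

variable {E F : Type*} [NormedAddCommGroup E] [NormedSpace ℝ E] [FiniteDimensional ℝ E]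
  [MeasurableSpace E] [BorelSpace E] [NormedAddCommGroup F] [NormedSpace ℝ F]
  [FiniteDimensional ℝ F] [MeasurableSpace F] [BorelSpace F]

/-- The expected squared norm of a Gaussian bilinear form is at most proportional to the sum of the
dimensions. -/
theorem lintegral_iSup_sq_le_of_gaussian {Ω ι : Type*} [MeasurableSpace Ω] (P : Measure Ω)
    [IsProbabilityMeasure P] (b : Ω → E →ₗ[ℝ] F →ₗ[ℝ] ℝ)
    (hb : Measurable fun p : Ω × E × F => b p.1 p.2.1 p.2.2) {L : ℝ} (hL : 0 < L)
    (hlaw : ∀ u z, ∃ v : NNReal, (v : ℝ) ≤ L * ‖u‖ ^ 2 * ‖z‖ ^ 2 ∧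
      P.map (fun ω => b ω u z) = gaussianReal 0 v)
    (u : ι → E) (z : ι → F) (hu : ∀ k, ‖u k‖ ≤ 1) (hz : ∀ k, ‖z k‖ ≤ 1) :
    ∫⁻ ω, ⨆ k, ENNReal.ofReal (b ω (u k) (z k) ^ 2) ∂P ≤
      ENNReal.ofReal (64 * L * (Module.finrank ℝ E + Module.finrank ℝ F + 2)) := by
  let μ : Measure E := Measure.addHaar
  let ν : Measure F := Measure.addHaar
  set d : ℕ := Module.finrank ℝ E + Module.finrank ℝ F with hd
  -- On the balls of radius two the variance is at most `16 L`, so this `t` meets `4tv ≤ 1`.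
  set t : ℝ := (64 * L)⁻¹ with ht
  have ht0 : 0 < t := by positivity
  obtain ⟨G, hGb⟩ : ∃ G : Ω → E → F → ℝ≥0∞, ∀ ω u z,
      G ω u z = ENNReal.ofReal (Real.exp (t * b ω u z ^ 2)) := ⟨_, fun _ _ _ => rfl⟩
  have hG : Measurable fun p : Ω × E × F => G p.1 p.2.1 p.2.2 := by
    simp only [hGb]
    exact ENNReal.measurable_ofReal.comp (Real.measurable_exp.comp ((hb.pow_const 2).const_mul t))
  have hG2 : ∀ ω u, Measurable (G ω u) := fun ω u =>
    hG.comp (measurable_const.prodMk (measurable_const.prodMk measurable_id))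
  obtain ⟨H, hHG⟩ : ∃ H : Ω → E → ℝ≥0∞, ∀ ω u, H ω u = ∫⁻ z in Metric.ball 0 2, G ω u z ∂ν :=
    ⟨_, fun _ _ => rfl⟩
  have hH : Measurable fun p : Ω × E => H p.1 p.2 := by
    simp only [hHG]
    refine Measurable.lintegral_prod_right' (f := fun q : (Ω × E) × F => G q.1.1 q.1.2 q.2) ?_
    exact hG.comp (f := fun q : (Ω × E) × F => (q.1.1, q.1.2, q.2)) (by fun_prop)
  let A : Ω → ℝ≥0∞ := fun ω => ∫⁻ u in Metric.ball 0 2, H ω u ∂μ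
  have hA : Measurable A := Measurable.lintegral_prod_right' hH
  have hm0 : μ (Metric.ball 0 1) ≠ 0 := (Metric.measure_ball_pos _ _ one_pos).ne'
  have hm1 : μ (Metric.ball 0 1) ≠ ∞ := measure_ball_lt_top.ne
  have hn0 : ν (Metric.ball 0 1) ≠ 0 := (Metric.measure_ball_pos _ _ one_pos).ne'
  have hn1 : ν (Metric.ball 0 1) ≠ ∞ := measure_ball_lt_top.ne
  set V := μ (Metric.ball 0 1) * ν (Metric.ball 0 1) with hV
  have hV0 : V ≠ 0 := mul_ne_zero hm0 hn0
  have hV1 : V ≠ ∞ := ENNReal.mul_ne_top hm1 hn1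
  -- The mean value inequality is applied in `z` for fixed `u`, then in `u` to the function already
  -- integrated over `z`.
  have hpoint : ∀ ω k, G ω (u k) (z k) ≤ V⁻¹ * A ω := fun ω k => by
    rw [mul_comm, ← div_eq_mul_inv, ENNReal.le_div_iff_mul_le (Or.inl hV0) (Or.inl hV1), mul_comm,
      hV, mul_assoc]
    have h1 : ν (Metric.ball 0 1) * G ω (u k) (z k) ≤ H ω (u k) := by
      rw [hHG]
      refine measure_ball_mul_le_setLIntegral ν (hG2 _ _) (hz k) fun h => ?_
      simp only [hGb, map_add, map_sub]
      exact exp_sq_midpoint ht0.le _ _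
    refine (mul_le_mul_right h1 _).trans ?_
    refine measure_ball_mul_le_setLIntegral μ (f := H ω) (hH.comp measurable_prodMk_left) (hu k) fun h => ?_
    simp only [hHG]
    rw [← lintegral_add_left (hG2 _ _), ← lintegral_add_left (hG2 _ _)]
    refine lintegral_mono fun z => ?_
    simp only [hGb, map_add, map_sub, LinearMap.add_apply, LinearMap.sub_apply]
    exact exp_sq_midpoint ht0.le _ _
  have hint : ∫⁻ ω, A ω ∂P ≤ 2 * (2 ^ d * V) := by
    have h1 : ∀ u ∈ Metric.ball (0 : E) 2, ∀ z ∈ Metric.ball (0 : F) 2, ∫⁻ ω, G ω u z ∂P ≤ 2 := by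
      intro u hu z hz
      rw [mem_ball_zero_iff] at hu hz
      obtain ⟨v, hv, hlaw⟩ := hlaw u z
      have hm : Measurable fun ω => b ω u z :=
        hb.comp (f := fun ω => (ω, u, z)) (by fun_prop)
      have h2 : ∫⁻ ω, G ω u z ∂P =
          ∫⁻ x, ENNReal.ofReal (Real.exp (t * x ^ 2)) ∂(P.map fun ω => b ω u z) :=
by
        rw [lintegral_map (f := fun x => ENNReal.ofReal (Real.exp (t * x ^ 2))) (by fun_prop) hm]
        simp only [hGb]
      rw [h2, hlaw]
      refine lintegral_exp_sq_gaussianReal_le ?_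
      have h3 : ‖u‖ ^ 2 ≤ 2 ^ 2 := pow_le_pow_left₀ (norm_nonneg _) hu.le 2
      have h4 : ‖z‖ ^ 2 ≤ 2 ^ 2 := pow_le_pow_left₀ (norm_nonneg _) hz.le 2
      have h5 : (v : ℝ) ≤ L * 2 ^ 2 * 2 ^ 2 := hv.trans (by gcongr)
      calc 4 * t * v ≤ 4 * t * (L * 2 ^ 2 * 2 ^ 2) := by gcongr
        _ = 1 := by rw [ht]; field_simp; norm_num
    have hswap : ∫⁻ ω, A ω ∂P = ∫⁻ u in Metric.ball 0 2, ∫⁻ z in Metric.ball 0 2,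
        ∫⁻ ω, G ω u z ∂P ∂ν ∂μ := by
      simp only [A]
      rw [lintegral_lintegral_swap hH.aemeasurable]
      refine lintegral_congr fun u => ?_
      simp only [hHG]
      rw [lintegral_lintegral_swap]
      exact (hG.comp (by fun_prop : Measurable fun p : Ω × F => (p.1, u, p.2))).aemeasurable
    rw [hswap]
    calc _ ≤ ∫⁻ u in Metric.ball (0 : E) 2, ∫⁻ z in Metric.ball (0 : F) 2, 2 ∂ν ∂μ := by
          refine setLIntegral_mono' Metric.isOpen_ball.measurableSet fun u hu => ?_
          exact setLIntegral_mono' Metric.isOpen_ball.measurableSet fun z hz => h1 u hu z hz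
      _ = _ := by
          rw [setLIntegral_const, setLIntegral_const, Measure.addHaar_ball_of_pos μ _ two_pos,
            Measure.addHaar_ball_of_pos ν _ two_pos, ENNReal.ofReal_pow two_pos.le,
            ENNReal.ofReal_pow two_pos.le, ENNReal.ofReal_ofNat, hV, hd, pow_add]
          ring
  -- Doubling the radii multiplies the volume by `2 ^ d`; this threshold makes `exp (-(t K)) = exp
  -- (-d)`, which absorbs that factor.
  set K : ℝ := d / t with hK
  set c : ℝ := t⁻¹ * Real.exp (-(t * K)) with hc
  have hc0 : 0 ≤ c := by positivity
  have hsup : ∀ ω, ⨆ k, ENNReal.ofReal (b ω (u k) (z k) ^ 2) ≤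
      ENNReal.ofReal K + ENNReal.ofReal c * (V⁻¹ * A ω) := fun ω => by
    refine iSup_le fun k => ?_
    calc ENNReal.ofReal (b ω (u k) (z k) ^ 2) ≤
        ENNReal.ofReal (K + c * Real.exp (t * b ω (u k) (z k) ^ 2)) :=
          ENNReal.ofReal_le_ofReal (le_add_exp_mul ht0 _ _)
      _ = ENNReal.ofReal K + ENNReal.ofReal c * G ω (u k) (z k) := by
          rw [ENNReal.ofReal_add (by positivity) (by positivity), ENNReal.ofReal_mul hc0, hGb]
      _ ≤ _ := by gcongr; exact hpoint ω k
  calc _ ≤ ∫⁻ ω, (ENNReal.ofReal K + ENNReal.ofReal c * (V⁻¹ * A ω)) ∂P := lintegral_mono hsup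
    _ = ENNReal.ofReal K + ENNReal.ofReal c * (V⁻¹ * ∫⁻ ω, A ω ∂P) := by
        rw [lintegral_add_left measurable_const, lintegral_const_mul _ (by fun_prop),
          lintegral_const_mul _ hA]
        simp
    _ ≤ ENNReal.ofReal K + ENNReal.ofReal c * (V⁻¹ * (2 * (2 ^ d * V))) := by gcongr
    _ = ENNReal.ofReal (K + c * (2 * 2 ^ d)) := by
        rw [ENNReal.ofReal_add (by positivity) (by positivity), ENNReal.ofReal_mul hc0,
          ENNReal.ofReal_mul two_pos.le, ENNReal.ofReal_pow two_pos.le, ENNReal.ofReal_ofNat]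
        congr 2
        rw [show V⁻¹ * (2 * (2 ^ d * V)) = 2 * 2 ^ d * (V⁻¹ * V) by ring,
          ENNReal.inv_mul_cancel hV0 hV1, mul_one]
    _ ≤ _ := by
        refine ENNReal.ofReal_le_ofReal ?_
        have h1 : Real.exp (-(t * K)) * 2 ^ d ≤ 1 := by
          rw [hK, mul_div_cancel₀ _ ht0.ne', Real.exp_neg, inv_mul_le_iff₀ (Real.exp_pos _), mul_one]
          calc (2 : ℝ) ^ d ≤ Real.exp 1 ^ d := by
                gcongr; linarith [Real.add_one_le_exp (1 : ℝ)]
            _ = Real.exp d := by rw [← Real.exp_nat_mul, mul_one]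
        have h2 : t⁻¹ = 64 * L := by rw [ht, inv_inv]
        have h3 : K = 64 * L * d := by rw [hK, div_eq_mul_inv, h2]; ring
        have h5 : c * (2 * 2 ^ d) ≤ 64 * L * 2 := by
          calc c * (2 * 2 ^ d) = 64 * L * 2 * (Real.exp (-(t * K)) * 2 ^ d) := by
                rw [hc, h2]; ring
            _ ≤ 64 * L * 2 * 1 := by gcongr
            _ = 64 * L * 2 := mul_one _
        have h4 : ((Module.finrank ℝ E : ℝ) + Module.finrank ℝ F) = d := by rw [hd]; push_cast; ring
        rw [h4, mul_add]
        linarith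

end

/-! ### Linear functionals of the Gaussian noise -/

lemma integral_inner_multivariateGaussian {d : ℕ} (S : Matrix (Fin d) (Fin d) ℝ)
    (u : EuclideanSpace ℝ (Fin d)) :
    ∫ e, inner ℝ u e ∂(multivariateGaussian 0 S) = 0 := by
  have h := ContinuousLinearMap.integral_comp_id_comm (L := innerSL ℝ u)
    (μ := multivariateGaussian 0 S) IsGaussian.integrable_id
  simpa using h

lemma variance_inner_multivariateGaussian {d : ℕ} {S : Matrix (Fin d) (Fin d) ℝ}
    (hS : S.PosSemidef) (u : EuclideanSpace ℝ (Fin d)) :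
    Var[fun e => inner ℝ u e; multivariateGaussian 0 S] = u ⬝ᵥ (S *ᵥ u) := by
  rw [← covarianceBilin_multivariateGaussian (μ := 0) hS, covarianceBilin_self]
  exact IsGaussian.memLp_two_id

lemma map_sum_inner_multivariateGaussian {d n : ℕ} {S : Matrix (Fin d) (Fin d) ℝ}
    (hS : S.PosSemidef) (u : EuclideanSpace ℝ (Fin d)) (a : Fin n → ℝ) :
    (Measure.pi fun _ : Fin n => multivariateGaussian 0 S).map
      (fun e => ∑ i, inner ℝ u (e i) * a i) =
      gaussianReal 0 ((u ⬝ᵥ (S *ᵥ u)) * ∑ i, a i ^ 2).toNNReal := by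
  let γ := multivariateGaussian (0 : EuclideanSpace ℝ (Fin d)) S
  have hL : ∀ i, HasGaussianLaw (fun e : EuclideanSpace ℝ (Fin d) => inner ℝ u e * a i) γ := by
    intro i
    exact (IsGaussian.hasGaussianLaw_id (μ := γ)).map (a i • innerSL ℝ u) |>.congr (by
      filter_upwards with e
      simp [mul_comm])
  have hmem : ∀ i, MemLp (fun e : EuclideanSpace ℝ (Fin d) => inner ℝ u e * a i) 2 γ :=
    fun i => (hL i).memLp_two
  have hind : iIndepFun (fun i (e : Fin n → EuclideanSpace ℝ (Fin d)) => inner ℝ u (e i) * a i)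
      (Measure.pi fun _ : Fin n => γ) :=
    iIndepFun_pi (X := fun i (e : EuclideanSpace ℝ (Fin d)) => inner ℝ u e * a i)
      fun i => (hL i).aemeasurable
  have hLi : ∀ i, HasGaussianLaw
      (fun e : Fin n → EuclideanSpace ℝ (Fin d) => inner ℝ u (e i) * a i)
      (Measure.pi fun _ : Fin n => γ) := fun i => by
    refine ⟨?_⟩
    have h1 := (hL i).isGaussian_map
    have h2 : (Measure.pi fun _ : Fin n => γ).map (fun e => e i) = γ :=
      (measurePreserving_eval (fun _ : Fin n => γ) i).map_eq
    rw [← h2, Measure.map_map (by fun_prop) (by fun_prop)] at h1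
    exact h1
  have hmean : ∫ e, ∑ i, inner ℝ u (e i) * a i ∂(Measure.pi fun _ : Fin n => γ) = 0 := by
    rw [integral_finsetSum _ fun i _ => (hLi i).integrable]
    refine Finset.sum_eq_zero fun i _ => ?_
    rw [integral_comp_eval (μ := fun _ : Fin n => γ) (i := i)
      (f := fun e : EuclideanSpace ℝ (Fin d) => inner ℝ u e * a i)
      (hL i).aemeasurable.aestronglyMeasurable,
      integral_mul_const, integral_inner_multivariateGaussian, zero_mul]
  have hvar : Var[fun e => ∑ i, inner ℝ u (e i) * a i; Measure.pi fun _ : Fin n => γ] =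
      (u ⬝ᵥ (S *ᵥ u)) * ∑ i, a i ^ 2 := by
    have h1 := variance_sum_pi hmem
    rw [show (∑ i, fun e : Fin n → EuclideanSpace ℝ (Fin d) => inner ℝ u (e i) * a i) =
      fun e => ∑ i, inner ℝ u (e i) * a i by ext; simp] at h1
    rw [h1, Finset.mul_sum]
    refine Finset.sum_congr rfl fun i _ => ?_
    rw [variance_mul_const, variance_inner_multivariateGaussian hS]
  rw [(iIndepFun.hasGaussianLaw_fun_sum hLi hind).map_eq_gaussianReal, hmean, hvar]

/-! ### The noise constant and its expectation -/

/-- The squared bilinear form `(uᵀ N) · (wᵀ X)`, relative to `|u|² |wᵀ X|²`. -/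
noncomputable def noiseRatio {dx dy n : ℕ} (X : Matrix (Fin dx) (Fin n) ℝ)
    (N : Matrix (Fin dy) (Fin n) ℝ) (p : (Fin dy → ℝ) × (Fin dx → ℝ)) : ℝ :=
  ((p.1 ᵥ* N) ⬝ᵥ (p.2 ᵥ* X)) ^ 2 / ((p.1 ⬝ᵥ p.1) * ((p.2 ᵥ* X) ⬝ᵥ (p.2 ᵥ* X)))

/-- The best constant in `NoiseBound`, as a countable supremum. -/
noncomputable def noiseSup {dx dy n : ℕ} (X : Matrix (Fin dx) (Fin n) ℝ)
    (N : Matrix (Fin dy) (Fin n) ℝ) : ℝ≥0∞ :=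
  ⨆ k, ENNReal.ofReal (noiseRatio X N (TopologicalSpace.denseSeq _ k))

/-- A crude bound, used for the finiteness of `noiseSup` and to see that the bilinear form vanishes
wherever the denominator of `noiseRatio` does. -/
lemma noiseBound_frobSq {dx dy n : ℕ} (X : Matrix (Fin dx) (Fin n) ℝ)
    (N : Matrix (Fin dy) (Fin n) ℝ) : NoiseBound X N (frobSq N) := fun u w => by
  have h1 : ((u ᵥ* N) ⬝ᵥ (w ᵥ* X)) ^ 2 ≤ ((u ᵥ* N) ⬝ᵥ (u ᵥ* N)) * ((w ᵥ* X) ⬝ᵥ (w ᵥ* X)) := by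
    simpa [dotProduct, sq] using Finset.sum_mul_sq_le_sq_mul_sq Finset.univ (u ᵥ* N) (w ᵥ* X)
  have h2 : (u ᵥ* N) ⬝ᵥ (u ᵥ* N) ≤ frobSq N * (u ⬝ᵥ u) := by
    have h3 : ∀ j, (u ᵥ* N) j ^ 2 ≤ (u ⬝ᵥ u) * ∑ i, N i j ^ 2 := fun j => by
      simpa [Matrix.vecMul, dotProduct, sq] using
        Finset.sum_mul_sq_le_sq_mul_sq Finset.univ u (fun i => N i j)
    calc (u ᵥ* N) ⬝ᵥ (u ᵥ* N) = ∑ j, (u ᵥ* N) j ^ 2 := by simp [dotProduct, sq]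
      _ ≤ ∑ j, (u ⬝ᵥ u) * ∑ i, N i j ^ 2 := Finset.sum_le_sum fun j _ => h3 j
      _ = frobSq N * (u ⬝ᵥ u) := by
          rw [← Finset.mul_sum, Finset.sum_comm, mul_comm, frobSq]
  exact h1.trans (mul_le_mul_of_nonneg_right h2 (Finset.sum_nonneg fun _ _ => mul_self_nonneg _))

lemma noiseSup_ne_top {dx dy n : ℕ} (X : Matrix (Fin dx) (Fin n) ℝ)
    (N : Matrix (Fin dy) (Fin n) ℝ) : noiseSup X N ≠ ∞ := by
  refine ne_top_of_le_ne_top (b := ENNReal.ofReal (frobSq N)) ENNReal.ofReal_ne_top ?_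
  refine iSup_le fun k => ENNReal.ofReal_le_ofReal ?_
  refine div_le_of_le_mul₀ ?_ (frobSq_nonneg N) ?_
  · exact mul_nonneg (Finset.sum_nonneg fun _ _ => mul_self_nonneg _)
      (Finset.sum_nonneg fun _ _ => mul_self_nonneg _)
  · rw [← mul_assoc]
    exact noiseBound_frobSq X N _ _

/-- For a fixed constant the inequality is a closed condition on `(u, w)`, so it extends from the
dense sequence to all vectors. -/
lemma noiseBound_noiseSup {dx dy n : ℕ} (X : Matrix (Fin dx) (Fin n) ℝ)
    (N : Matrix (Fin dy) (Fin n) ℝ) : NoiseBound X N (noiseSup X N).toReal := by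
  set c := (noiseSup X N).toReal
  have hclosed : IsClosed {p : (Fin dy → ℝ) × (Fin dx → ℝ) | ((p.1 ᵥ* N) ⬝ᵥ (p.2 ᵥ* X)) ^ 2 ≤
      c * (p.1 ⬝ᵥ p.1) * ((p.2 ᵥ* X) ⬝ᵥ (p.2 ᵥ* X))} :=
    isClosed_le (by fun_prop) (by fun_prop)
  have hdense : ∀ p : (Fin dy → ℝ) × (Fin dx → ℝ), ((p.1 ᵥ* N) ⬝ᵥ (p.2 ᵥ* X)) ^ 2 ≤
      c * (p.1 ⬝ᵥ p.1) * ((p.2 ᵥ* X) ⬝ᵥ (p.2 ᵥ* X)) := by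
    intro p
    have h := (TopologicalSpace.denseRange_denseSeq ((Fin dy → ℝ) × (Fin dx → ℝ))).closure_eq ▸
      Set.mem_univ p
    refine closure_minimal ?_ hclosed h
    rintro _ ⟨k, rfl⟩
    set q := TopologicalSpace.denseSeq ((Fin dy → ℝ) × (Fin dx → ℝ)) k
    have h1 : noiseRatio X N q ≤ c := by
      rw [← ENNReal.ofReal_le_iff_le_toReal (noiseSup_ne_top X N)]
      exact le_iSup (fun k => ENNReal.ofReal (noiseRatio X N (TopologicalSpace.denseSeq _ k))) k
    have h0 : 0 ≤ (q.1 ⬝ᵥ q.1) * ((q.2 ᵥ* X) ⬝ᵥ (q.2 ᵥ* X)) :=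
      mul_nonneg (Finset.sum_nonneg fun _ _ => mul_self_nonneg _)
        (Finset.sum_nonneg fun _ _ => mul_self_nonneg _)
    rw [Set.mem_ofPred_eq, mul_assoc]
    rcases h0.eq_or_lt with h0 | h0
    · have := noiseBound_frobSq X N q.1 q.2
      rw [mul_assoc, ← h0, mul_zero] at this
      rwa [← h0, mul_zero]
    · exact (div_le_iff₀ h0).1 h1
  exact fun u w => hdense (u, w)

lemma measurable_noiseSup_colMatrix {dx dy n : ℕ} :
    Measurable fun p : (Fin n → EuclideanSpace ℝ (Fin dx)) × (Fin n → EuclideanSpace ℝ (Fin dy)) =>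
      noiseSup (colMatrix p.1) (colMatrix p.2) := by
  refine Measurable.iSup fun k => ENNReal.measurable_ofReal.comp ?_
  simp only [noiseRatio, colMatrix, Matrix.vecMul, dotProduct, Matrix.of_apply]
  fun_prop

lemma lintegral_noiseSup_le {dx dy n : ℕ} {S : Matrix (Fin dy) (Fin dy) ℝ} (hS : S.PosSemidef)
    {L : ℝ} (hL : 0 < L) (hSL : lambdaMax S ≤ L) (X : Matrix (Fin dx) (Fin n) ℝ) :
    ∫⁻ e, noiseSup X (colMatrix e) ∂(Measure.pi fun _ : Fin n => multivariateGaussian 0 S) ≤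
      ENNReal.ofReal (64 * L * (dx + dy + 2)) := by
  let T : EuclideanSpace ℝ (Fin dx) →ₗ[ℝ] EuclideanSpace ℝ (Fin n) := Matrix.toEuclideanLin Xᵀ
  -- Taking the row space of `X` as second argument, and not the whole `n`-dimensional space, keeps
  -- `n` out of the bound.
  let F := LinearMap.range T
  have hF : Module.finrank ℝ F ≤ dx := by
    simpa using LinearMap.finrank_range_le T
  let b : (Fin n → EuclideanSpace ℝ (Fin dy)) → EuclideanSpace ℝ (Fin dy) →ₗ[ℝ] F →ₗ[ℝ] ℝ :=
    fun e => LinearMap.mk₂ ℝ (fun u z => ∑ i, inner ℝ u (e i) * (z : EuclideanSpace ℝ (Fin n)) i)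
      (fun u u' z => by simp [inner_add_left, add_mul, Finset.sum_add_distrib])
      (fun c u z => by simp [real_inner_smul_left, Finset.mul_sum, mul_assoc])
      (fun u z z' => by simp [mul_add, Finset.sum_add_distrib])
      (fun c u z => by
        simp only [Submodule.coe_smul, PiLp.smul_apply, smul_eq_mul, Finset.mul_sum]
        exact Finset.sum_congr rfl fun _ _ => by ring)
  let p := TopologicalSpace.denseSeq ((Fin dy → ℝ) × (Fin dx → ℝ))
  let u₀ : ℕ → EuclideanSpace ℝ (Fin dy) := fun k => WithLp.toLp 2 (p k).1
  let z₀ : ℕ → F := fun k => ⟨T (WithLp.toLp 2 (p k).2), LinearMap.mem_range_self _ _⟩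
  have hz₀ : ∀ k i, (z₀ k : EuclideanSpace ℝ (Fin n)) i = ((p k).2 ᵥ* X) i := fun k i => by
    simp [z₀, T, Matrix.toLpLin_apply, Matrix.mulVec_transpose]
  have hb : Measurable fun q : (Fin n → EuclideanSpace ℝ (Fin dy)) × EuclideanSpace ℝ (Fin dy) × F
      => b q.1 q.2.1 q.2.2 := by
    simp only [b, LinearMap.mk₂_apply]
    fun_prop
  have key := lintegral_iSup_sq_le_of_gaussian
    (Measure.pi fun _ : Fin n => multivariateGaussian 0 S) b hb hL
    (fun u z => ⟨_, ?_, map_sum_inner_multivariateGaussian hS u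
      (fun i => (z : EuclideanSpace ℝ (Fin n)) i)⟩)
    (fun k => ‖u₀ k‖⁻¹ • u₀ k) (fun k => ‖z₀ k‖⁻¹ • z₀ k)
    -- Normalizing a zero vector yields zero, consistent with the value `0` of `noiseRatio` there.
    (fun k => by
      rw [norm_smul, norm_inv, norm_norm]; exact inv_mul_le_one_of_le₀ le_rfl (norm_nonneg _))
    (fun k => by
      rw [norm_smul, norm_inv, norm_norm]; exact inv_mul_le_one_of_le₀ le_rfl (norm_nonneg _))
  · refine le_trans (lintegral_mono fun e => iSup_mono fun k => ?_) (key.trans ?_)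
    · refine le_of_eq (congrArg ENNReal.ofReal ?_)
      have h1 : b e (u₀ k) (z₀ k) = ((p k).1 ᵥ* colMatrix e) ⬝ᵥ ((p k).2 ᵥ* X) := by
        simp only [b, LinearMap.mk₂_apply, hz₀]
        refine Finset.sum_congr rfl fun i _ => ?_
        congr 1
        simp [u₀, colMatrix, Matrix.vecMul, dotProduct, PiLp.inner_apply, mul_comm]
      have h2 : ‖u₀ k‖ ^ 2 = (p k).1 ⬝ᵥ (p k).1 := by
        rw [EuclideanSpace.real_norm_sq_eq]; simp [u₀, dotProduct, sq]
      have h3 : ‖z₀ k‖ ^ 2 = ((p k).2 ᵥ* X) ⬝ᵥ ((p k).2 ᵥ* X) := by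
        rw [Submodule.coe_norm, EuclideanSpace.real_norm_sq_eq]; simp [hz₀, dotProduct, sq]
      have h4 : b e (‖u₀ k‖⁻¹ • u₀ k) (‖z₀ k‖⁻¹ • z₀ k) = ‖z₀ k‖⁻¹ * (‖u₀ k‖⁻¹ * b e (u₀ k) (z₀ k)) := by
        simp only [map_smul, LinearMap.smul_apply, smul_eq_mul]
      change _ / _ = _
      rw [h4, ← h1, ← h2, ← h3, mul_pow, mul_pow, inv_pow, inv_pow, div_eq_mul_inv, mul_inv]
      ring
    · refine ENNReal.ofReal_le_ofReal ?_
      have : (Module.finrank ℝ F : ℝ) ≤ dx := by exact_mod_cast hF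
      rw [finrank_euclideanSpace_fin]
      gcongr 64 * L * (?_ + 2)
      linarith
  · have h1 : ‖z‖ ^ 2 = ∑ i, (z : EuclideanSpace ℝ (Fin n)) i ^ 2 := by
      rw [Submodule.coe_norm, EuclideanSpace.real_norm_sq_eq]
    have h2 : ‖u‖ ^ 2 = u ⬝ᵥ u := by
      rw [EuclideanSpace.real_norm_sq_eq]; simp [dotProduct, sq]
    have h3 : u ⬝ᵥ (S *ᵥ u) ≤ L * (u ⬝ᵥ u) := by
      refine (dotProduct_mulVec_le_lambdaMax hS.isHermitian u).trans ?_
      exact mul_le_mul_of_nonneg_right hSL (Finset.sum_nonneg fun _ _ => mul_self_nonneg _)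
    have h4 : 0 ≤ u ⬝ᵥ (S *ᵥ u) := by simpa using hS.dotProduct_mulVec_nonneg u
    rw [Real.coe_toNNReal _ (mul_nonneg h4 (Finset.sum_nonneg fun _ _ => sq_nonneg _)), h1, h2]
    gcongr

lemma lambdaMax_nonneg {d : ℕ} {S : Matrix (Fin d) (Fin d) ℝ} (hS : S.PosSemidef) :
    0 ≤ lambdaMax S :=
  Real.sSup_nonneg fun _ hx =>
    (Matrix.posSemidef_iff_isHermitian_and_spectrum_nonneg.1 hS).2 hx

/-- Limit `L ↓ lambdaMax S`: the previous bound needs `L > 0`, while degenerate noise has `lambdaMax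
S = 0`. -/
lemma lintegral_noiseSup_le_lambdaMax {dx dy n : ℕ} {S : Matrix (Fin dy) (Fin dy) ℝ}
    (hS : S.PosSemidef) (X : Matrix (Fin dx) (Fin n) ℝ) :
    ∫⁻ e, noiseSup X (colMatrix e) ∂(Measure.pi fun _ : Fin n => multivariateGaussian 0 S) ≤
      ENNReal.ofReal (64 * lambdaMax S * (dx + dy + 2)) := by
  have hc : Continuous fun L : ℝ => ENNReal.ofReal (64 * L * (dx + dy + 2)) :=
    ENNReal.continuous_ofReal.comp (by fun_prop)
  refine ge_of_tendsto (hc.continuousWithinAt (s := Set.Ioi (lambdaMax S))) ?_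
  filter_upwards [self_mem_nhdsWithin] with L hL
  exact lintegral_noiseSup_le hS ((lambdaMax_nonneg hS).trans_lt hL) hL.le X

/-! ### Population covariance, risk, and the law of features and noise -/

section popCov

variable {d : ℕ} {μ : Measure (EuclideanSpace ℝ (Fin d))}

lemma memLp_apply (hμ : MemLp id 2 μ) (i : Fin d) : MemLp (fun x => x i) 2 μ :=
  (EuclideanSpace.proj (𝕜 := ℝ) i).comp_memLp' hμ

lemma memLp_dotProduct (hμ : MemLp id 2 μ) (w : Fin d → ℝ) : MemLp (fun x : EuclideanSpace ℝ (Fin d) => w ⬝ᵥ x) 2 μ :=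
  memLp_finsetSum _ fun i _ => (memLp_apply hμ i).const_mul (w i)

lemma dotProduct_popCov (hμ : MemLp id 2 μ) (w : Fin d → ℝ) :
    w ⬝ᵥ (popCov μ *ᵥ w) = ∫ x, (w ⬝ᵥ x) ^ 2 ∂μ := by
  have hint : ∀ i j, Integrable (fun x : EuclideanSpace ℝ (Fin d) => w i * (x i * x j * w j)) μ :=
    fun i j => (((memLp_apply hμ i).integrable_mul (memLp_apply hμ j)).mul_const _).const_mul _
  have h1 : ∀ x : EuclideanSpace ℝ (Fin d), (w ⬝ᵥ x) ^ 2 = ∑ i, ∑ j, w i * (x i * x j * w j) := by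
    intro x
    rw [sq, dotProduct, Finset.sum_mul_sum]
    exact Finset.sum_congr rfl fun i _ => Finset.sum_congr rfl fun j _ => by ring
  simp_rw [h1]
  rw [integral_finsetSum _ fun i _ => integrable_finsetSum _ fun j _ => hint i j]
  simp_rw [dotProduct, Matrix.mulVec, dotProduct, Finset.mul_sum]
  refine Finset.sum_congr rfl fun i _ => ?_
  rw [integral_finsetSum _ fun j _ => hint i j]
  refine Finset.sum_congr rfl fun j _ => ?_
  rw [integral_const_mul, integral_mul_const, popCov, Matrix.of_apply]

lemma posSemidef_popCov (hμ : MemLp id 2 μ) : (popCov μ).PosSemidef := by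
  refine Matrix.PosSemidef.of_dotProduct_mulVec_nonneg ?_ fun w => ?_
  · ext i j
    simp [popCov, mul_comm]
  · rw [star_trivial, dotProduct_popCov hμ]
    exact integral_nonneg fun _ => sq_nonneg _

lemma norm_toEuclideanLin_sq {m : ℕ} (E : Matrix (Fin m) (Fin d) ℝ)
    (x : EuclideanSpace ℝ (Fin d)) : ‖Matrix.toEuclideanLin E x‖ ^ 2 = ∑ i, (E i ⬝ᵥ x) ^ 2 := by
  rw [EuclideanSpace.real_norm_sq_eq]
  rfl

lemma lintegral_norm_toEuclideanLin_sq (hμ : MemLp id 2 μ) {m : ℕ}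
    (E : Matrix (Fin m) (Fin d) ℝ) :
    ∫⁻ x, ENNReal.ofReal (‖Matrix.toEuclideanLin E x‖ ^ 2) ∂μ =
      ENNReal.ofReal (E * popCov μ * Eᵀ).trace := by
  have hint : ∀ i, Integrable (fun x : EuclideanSpace ℝ (Fin d) => (E i ⬝ᵥ x) ^ 2) μ :=
    fun i => (memLp_dotProduct hμ (E i)).integrable_sq
  simp_rw [norm_toEuclideanLin_sq]
  rw [← ofReal_integral_eq_lintegral_ofReal (integrable_finsetSum _ fun i _ => hint i)
    (Filter.Eventually.of_forall fun _ => Finset.sum_nonneg fun _ _ => sq_nonneg _),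
    integral_finsetSum _ fun i _ => hint i, trace_mul_mul_transpose]
  simp_rw [dotProduct_popCov hμ]

end popCov

section risk

variable {dx dy : ℕ} {μ : Measure (EuclideanSpace ℝ (Fin dx))}
  {S : Matrix (Fin dy) (Fin dy) ℝ}

/-- The second moment of the noise. -/
noncomputable def noiseRisk (S : Matrix (Fin dy) (Fin dy) ℝ) : ℝ≥0∞ :=
  ∫⁻ e, ENNReal.ofReal (‖e‖ ^ 2) ∂(multivariateGaussian 0 S)

lemma integrable_norm_sq_noise (S : Matrix (Fin dy) (Fin dy) ℝ) :
    Integrable (fun e => ‖e‖ ^ 2) (multivariateGaussian 0 S) :=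
  (IsGaussian.memLp_two_id (μ := multivariateGaussian 0 S)).norm.integrable_sq

lemma noiseRisk_ne_top (S : Matrix (Fin dy) (Fin dy) ℝ) : noiseRisk S ≠ ∞ := by
  rw [noiseRisk, ← ofReal_integral_eq_lintegral_ofReal (integrable_norm_sq_noise S)
    (Filter.Eventually.of_forall fun _ => by positivity)]
  exact ENNReal.ofReal_ne_top

lemma lintegral_norm_sub_sq (S : Matrix (Fin dy) (Fin dy) ℝ) (v : EuclideanSpace ℝ (Fin dy)) :
    ∫⁻ e, ENNReal.ofReal (‖v - e‖ ^ 2) ∂(multivariateGaussian 0 S) =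
      ENNReal.ofReal (‖v‖ ^ 2) + noiseRisk S := by
  have hi : Integrable (fun e => inner ℝ v e) (multivariateGaussian 0 S) :=
    ((innerSL ℝ v).comp_memLp' (IsGaussian.memLp_two_id (μ := multivariateGaussian 0 S))).integrable
      (by norm_num)
  have h2 := integrable_norm_sq_noise S
  have h1 : Integrable (fun e => ‖v‖ ^ 2 - 2 * inner ℝ v e) (multivariateGaussian 0 S) :=
    (integrable_const _).sub (hi.const_mul 2)
  have h3 : Integrable (fun e => ‖v - e‖ ^ 2) (multivariateGaussian 0 S) := by
    simp_rw [norm_sub_sq_real]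
    exact h1.add h2
  rw [← ofReal_integral_eq_lintegral_ofReal h3
    (Filter.Eventually.of_forall fun _ => by positivity)]
  simp_rw [norm_sub_sq_real]
  rw [integral_add h1 h2, integral_sub (integrable_const _) (hi.const_mul 2), integral_const_mul,
    integral_inner_multivariateGaussian, noiseRisk, ← ofReal_integral_eq_lintegral_ofReal h2
      (Filter.Eventually.of_forall fun _ => by positivity),
    ← ENNReal.ofReal_add (by positivity) (integral_nonneg fun _ => by positivity)]
  simp

lemma measurable_sampleMap (A : Matrix (Fin dy) (Fin dx) ℝ) :
    Measurable fun p : EuclideanSpace ℝ (Fin dx) × EuclideanSpace ℝ (Fin dy) =>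
      (p.1, Matrix.toEuclideanLin A p.1 + p.2) := by
  have := (Matrix.toEuclideanLin A).continuous_of_finiteDimensional.measurable
  fun_prop

/-- The fresh noise is centred and independent of the features, so the cross term vanishes and the
noise contributes a constant independent of `A`. -/
lemma risk_sampleLaw [IsProbabilityMeasure μ] (hμ : MemLp id 2 μ) (Astar A : Matrix (Fin dy) (Fin dx) ℝ) :
    risk (sampleLaw Astar μ S) A =
      ENNReal.ofReal ((A - Astar) * popCov μ * (A - Astar)ᵀ).trace + noiseRisk S := by
  have hA := (Matrix.toEuclideanLin A).continuous_of_finiteDimensional.measurable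
  have hE := (Matrix.toEuclideanLin (A - Astar)).continuous_of_finiteDimensional.measurable
  rw [risk, sampleLaw, lintegral_map (by fun_prop) (measurable_sampleMap Astar)]
  have h1 : ∀ p : EuclideanSpace ℝ (Fin dx) × EuclideanSpace ℝ (Fin dy),
      Matrix.toEuclideanLin A p.1 - (Matrix.toEuclideanLin Astar p.1 + p.2) =
        Matrix.toEuclideanLin (A - Astar) p.1 - p.2 := fun p => by
    rw [map_sub, LinearMap.sub_apply]; abel
  simp_rw [h1]
  rw [lintegral_prod _ (by fun_prop)]
  simp_rw [lintegral_norm_sub_sq]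
  rw [lintegral_add_right _ measurable_const, lintegral_norm_toEuclideanLin_sq hμ]
  simp

lemma map_sampleLaw (A : Matrix (Fin dy) (Fin dx) ℝ) :
    (sampleLaw A μ S).map (fun p => (p.1, p.2 - Matrix.toEuclideanLin A p.1)) =
      μ.prod (multivariateGaussian 0 S) := by
  have hA := (Matrix.toEuclideanLin A).continuous_of_finiteDimensional.measurable
  rw [sampleLaw, Measure.map_map (by fun_prop) (measurable_sampleMap A)]
  convert Measure.map_id
  ext p <;> simp

/-- Subtracting `A x` undoes the construction of `sampleLaw`; a product of `n` product measures is
then regrouped as features times noise. -/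
lemma hasLaw_features_noise [IsProbabilityMeasure μ] {n : ℕ} {Ω : Type*} [MeasurableSpace Ω] {P : Measure Ω}
    {A : Matrix (Fin dy) (Fin dx) ℝ}
    {x : Fin n → Ω → EuclideanSpace ℝ (Fin dx)} {y : Fin n → Ω → EuclideanSpace ℝ (Fin dy)}
    (hind : iIndepFun (fun i ω => (x i ω, y i ω)) P)
    (hlaw : ∀ i, HasLaw (fun ω => (x i ω, y i ω)) (sampleLaw A μ S) P) :
    HasLaw (fun ω => (fun i => x i ω, fun i => y i ω - Matrix.toEuclideanLin A (x i ω)))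
      ((Measure.pi fun _ : Fin n => μ).prod
        (Measure.pi fun _ : Fin n => multivariateGaussian 0 S)) P := by
  have hA := (Matrix.toEuclideanLin A).continuous_of_finiteDimensional.measurable
  let φ : EuclideanSpace ℝ (Fin dx) × EuclideanSpace ℝ (Fin dy) →
      EuclideanSpace ℝ (Fin dx) × EuclideanSpace ℝ (Fin dy) :=
    fun p => (p.1, p.2 - Matrix.toEuclideanLin A p.1)
  have hφ : Measurable φ := by fun_prop
  have h1 : ∀ i, HasLaw (fun ω => φ (x i ω, y i ω)) (μ.prod (multivariateGaussian 0 S)) P :=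
    fun i => HasLaw.comp ⟨hφ.aemeasurable, map_sampleLaw A⟩ (hlaw i)
  have h2 := iIndepFun.hasLaw_pi h1 (hind.comp (fun _ => φ) fun _ => hφ)
  have h3 := measurePreserving_arrowProdEquivProdArrow (EuclideanSpace ℝ (Fin dx))
    (EuclideanSpace ℝ (Fin dy)) (Fin n) (fun _ => μ) (fun _ => multivariateGaussian 0 S)
  exact HasLaw.comp ⟨h3.measurable.aemeasurable, h3.map_eq⟩ h2

end risk

/-! ### Empirical against population covariance -/

/-- A countable supremum that bounds the quadratic form of `Q` by that of `empCov X`. -/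
noncomputable def covRatio {dx n : ℕ} (Q : Matrix (Fin dx) (Fin dx) ℝ)
    (X : Matrix (Fin dx) (Fin n) ℝ) : ℝ≥0∞ :=
  ⨆ k, ENNReal.ofReal (TopologicalSpace.denseSeq (Fin dx → ℝ) k ⬝ᵥ
    (Q *ᵥ TopologicalSpace.denseSeq (Fin dx → ℝ) k) / (TopologicalSpace.denseSeq (Fin dx → ℝ) k ⬝ᵥ
    (empCov X *ᵥ TopologicalSpace.denseSeq (Fin dx → ℝ) k)))

section covRatio

variable {dx n : ℕ} {Q : Matrix (Fin dx) (Fin dx) ℝ} {X : Matrix (Fin dx) (Fin n) ℝ}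

lemma covRatio_le (hQ : Q.PosSemidef) (hX : IsUnit (empCov X)) :
    covRatio Q X ≤ ENNReal.ofReal (lambdaMax (Q * (empCov X)⁻¹)) := by
  refine iSup_le fun k => ?_
  set w := TopologicalSpace.denseSeq (Fin dx → ℝ) k
  have h0 : 0 ≤ w ⬝ᵥ (empCov X *ᵥ w) := by
    simpa using (posSemidef_empCov X).dotProduct_mulVec_nonneg w
  rcases h0.eq_or_lt with h0 | h0
  -- A zero denominator gives the ratio zero.
  · simp [← h0]
  · refine ENNReal.ofReal_le_ofReal ((div_le_iff₀ h0).2 ?_)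
    exact dotProduct_mulVec_le_lambdaMax_mul_inv hQ (posSemidef_empCov X) hX w

lemma dotProduct_mulVec_le_covRatio (hQ : Q.PosSemidef) (hX : IsUnit (empCov X)) (w : Fin dx → ℝ) :
    w ⬝ᵥ (Q *ᵥ w) ≤ (covRatio Q X).toReal * (w ⬝ᵥ (empCov X *ᵥ w)) := by
  have hclosed : IsClosed {w : Fin dx → ℝ |
      w ⬝ᵥ (Q *ᵥ w) ≤ (covRatio Q X).toReal * (w ⬝ᵥ (empCov X *ᵥ w))} :=
    isClosed_le (by fun_prop) (by fun_prop)
  have h := (TopologicalSpace.denseRange_denseSeq (Fin dx → ℝ)).closure_eq ▸ Set.mem_univ w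
  refine closure_minimal ?_ hclosed h
  rintro _ ⟨k, rfl⟩
  rw [Set.mem_ofPred_eq]
  have h1 := le_iSup (fun k => ENNReal.ofReal (TopologicalSpace.denseSeq (Fin dx → ℝ) k ⬝ᵥ
    (Q *ᵥ TopologicalSpace.denseSeq (Fin dx → ℝ) k) / (TopologicalSpace.denseSeq (Fin dx → ℝ) k ⬝ᵥ
    (empCov X *ᵥ TopologicalSpace.denseSeq (Fin dx → ℝ) k)))) k
  rw [← covRatio, ENNReal.ofReal_le_iff_le_toReal
    (ne_top_of_le_ne_top ENNReal.ofReal_ne_top (covRatio_le hQ hX))] at h1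
  have h0 := (posSemidef_empCov X).dotProduct_mulVec_nonneg
    (TopologicalSpace.denseSeq (Fin dx → ℝ) k)
  rw [star_trivial] at h0
  rcases h0.eq_or_lt with h0 | h0
  -- The ratio carries no information at a zero denominator; the eigenvalue bound shows that the
  -- form of `Q` is nonpositive there.
  · have := dotProduct_mulVec_le_lambdaMax_mul_inv hQ (posSemidef_empCov X) hX
      (TopologicalSpace.denseSeq (Fin dx → ℝ) k)
    rw [← h0, mul_zero] at this
    rwa [← h0, mul_zero]
  · exact (div_le_iff₀ h0).1 h1

lemma measurable_covRatio_colMatrix (Q : Matrix (Fin dx) (Fin dx) ℝ) :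
    Measurable fun x : Fin n → EuclideanSpace ℝ (Fin dx) => covRatio Q (colMatrix x) := by
  refine Measurable.iSup fun k => ENNReal.measurable_ofReal.comp ?_
  simp only [dotProduct_empCov]
  simp only [colMatrix, Matrix.vecMul, dotProduct, Matrix.of_apply]
  fun_prop

end covRatio

/-! ### Excess risk and independence -/

/-- The excess risk of a LoRA solution is controlled by `covRatio` and `noiseSup`. -/
lemma trace_popCov_le_of_isLoRASolution {dx dy n r : ℕ} (hn : 0 < n) (hrd : r < min dx dy)
    {Q : Matrix (Fin dx) (Fin dx) ℝ} (hQ : Q.PosSemidef) {X : Matrix (Fin dx) (Fin n) ℝ}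
    {Y : Matrix (Fin dy) (Fin n) ℝ} {A Astar A₀ : Matrix (Fin dy) (Fin dx) ℝ}
    (hX : IsUnit (empCov X)) (hr : (Astar - A₀).rank ≤ r) (hA : IsLoRASolution r A₀ X Y A) :
    ENNReal.ofReal ((A - Astar) * Q * (A - Astar)ᵀ).trace ≤
      ENNReal.ofReal (8 * r / n) * (covRatio Q X * noiseSup X (Y - Astar * X)) := by
  have hn' : (0 : ℝ) < n := by positivity
  have h1 := frobSq_mul_le_of_isLoRASolution hn hrd ENNReal.toReal_nonneg hX
    (noiseBound_noiseSup X (Y - Astar * X)) hr hA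
  rw [frobSq_mul_eq_empCov hn] at h1
  have h2 := trace_mul_mul_transpose_le (A - Astar) (dotProduct_mulVec_le_covRatio hQ hX)
  have h3 : covRatio Q X ≠ ∞ := ne_top_of_le_ne_top ENNReal.ofReal_ne_top (covRatio_le hQ hX)
  rw [← ENNReal.ofReal_toReal h3, ← ENNReal.ofReal_toReal (noiseSup_ne_top X (Y - Astar * X)),
    ← ENNReal.ofReal_mul ENNReal.toReal_nonneg, ← ENNReal.ofReal_mul (by positivity)]
  refine ENNReal.ofReal_le_ofReal (h2.trans ?_)
  calc (covRatio Q X).toReal * ((A - Astar) * empCov X * (A - Astar)ᵀ).trace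
      ≤ (covRatio Q X).toReal * (8 * r * (noiseSup X (Y - Astar * X)).toReal / n) := by
        gcongr
        rw [le_div_iff₀ hn', mul_comm]
        exact h1
    _ = _ := by ring

lemma colMatrix_sub_mul_colMatrix {dx dy n : ℕ} (A : Matrix (Fin dy) (Fin dx) ℝ)
    (x : Fin n → EuclideanSpace ℝ (Fin dx)) (y : Fin n → EuclideanSpace ℝ (Fin dy)) :
    colMatrix y - A * colMatrix x = colMatrix fun i => y i - Matrix.toEuclideanLin A (x i) := by
  ext i j
  simp [colMatrix, Matrix.mul_apply, Matrix.toLpLin_apply, Matrix.mulVec, dotProduct]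

/-- Independence of features and noise separates the two factors. -/
lemma lintegral_covRatio_mul_noiseSup_le {dx dy n : ℕ}
    {μ : Measure (EuclideanSpace ℝ (Fin dx))} [IsProbabilityMeasure μ]
    {S : Matrix (Fin dy) (Fin dy) ℝ} (hS : S.PosSemidef) (Q : Matrix (Fin dx) (Fin dx) ℝ)
    {Ω : Type*} [MeasurableSpace Ω] {P : Measure Ω}
    {x : Ω → Fin n → EuclideanSpace ℝ (Fin dx)} {e : Ω → Fin n → EuclideanSpace ℝ (Fin dy)}
    (h : HasLaw (fun ω => (x ω, e ω)) ((Measure.pi fun _ : Fin n => μ).prod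
        (Measure.pi fun _ : Fin n => multivariateGaussian 0 S)) P) :
    ∫⁻ ω, covRatio Q (colMatrix (x ω)) * noiseSup (colMatrix (x ω)) (colMatrix (e ω)) ∂P ≤
      ENNReal.ofReal (64 * lambdaMax S * (dx + dy + 2)) *
        ∫⁻ ω, covRatio Q (colMatrix (x ω)) ∂P := by
  have hf := measurable_covRatio_colMatrix (n := n) Q
  have hg := measurable_noiseSup_colMatrix (dx := dx) (dy := dy) (n := n)
  have hcg := fun z => lintegral_noiseSup_le_lambdaMax (dx := dx) (n := n) hS (colMatrix z)
  generalize ENNReal.ofReal (64 * lambdaMax S * (dx + dy + 2)) = c at *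
  generalize hfdef : (fun z : Fin n → EuclideanSpace ℝ (Fin dx) => covRatio Q (colMatrix z)) = f at *
  generalize hgdef : (fun p : (Fin n → EuclideanSpace ℝ (Fin dx)) ×
    (Fin n → EuclideanSpace ℝ (Fin dy)) => noiseSup (colMatrix p.1) (colMatrix p.2)) = g at *
  have hf' : ∀ z, covRatio Q (colMatrix z) = f z := fun z => congrFun hfdef z
  have hg' : ∀ z w, noiseSup (colMatrix z) (colMatrix w) = g (z, w) := fun z w =>
    congrFun hgdef (z, w)
  simp only [hf', hg'] at hcg ⊢
  have h1 := h.lintegral_comp (f := fun p => f p.1 * g p) (by fun_prop)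
  have h2 := h.lintegral_comp (f := fun p => f p.1) (by fun_prop)
  rw [lintegral_prod _ (by fun_prop)] at h1 h2
  simp only [lintegral_const, measure_univ, mul_one] at h2
  -- After Tonelli, the inner integral over the noise is bounded by `c` for each fixed feature
  -- sample `z`.
  rw [h1, h2, mul_comm, ← lintegral_mul_const _ hf]
  refine lintegral_mono fun z => ?_
  simp only
  rw [lintegral_const_mul _ (by fun_prop)]
  gcongr
  exact hcg z

end LoRA

/-- There is an absolute constant `C` such that, in the overdetermined regime and for a task shift
`Astar - A₀` of rank at most `r < min dx dy < n` (where `Astar` is the ground truth), both bias terms are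
zero and the expected excess risk of LoRA is at most `C` times the variance term. Expectations
of nonnegative quantities are taken in `[0, ∞]`; the risk of `Astar` is finite. -/
theorem mainTheorem3 :
    ∃ C : ℝ, 0 < C ∧
      ∀ (dx dy n r : ℕ) (Astar A₀ : Matrix (Fin dy) (Fin dx) ℝ)
        (μ : Measure (EuclideanSpace ℝ (Fin dx))) [IsProbabilityMeasure μ]
        (S : Matrix (Fin dy) (Fin dy) ℝ)
        (Ω : Type*) [MeasurableSpace Ω] (P : Measure Ω) [IsProbabilityMeasure P]
        (x : Fin n → Ω → EuclideanSpace ℝ (Fin dx))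
        (y : Fin n → Ω → EuclideanSpace ℝ (Fin dy))
        (Ahat : Ω → Matrix (Fin dy) (Fin dx) ℝ),
        -- the population: square-integrable features with covariance of full rank, Gaussian noise
        MemLp id 2 μ → (LoRA.popCov μ).rank = dx → S.PosSemidef →
        -- the training set: `n` i.i.d. samples with almost surely invertible empirical covariance
        iIndepFun (fun i ω => (x i ω, y i ω)) P →
        (∀ i, HasLaw (fun ω => (x i ω, y i ω)) (LoRA.sampleLaw Astar μ S) P) →
        (∀ᵐ ω ∂P, IsUnit (LoRA.empCov (LoRA.colMatrix fun i => x i ω))) →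
        -- the estimator
        (∀ i j, AEMeasurable (fun ω => Ahat ω i j) P) →
        (∀ᵐ ω ∂P, LoRA.IsLoRASolution r A₀ (LoRA.colMatrix fun i => x i ω)
          (LoRA.colMatrix fun i => y i ω) (Ahat ω)) →
        -- the rank condition
        (Astar - A₀).rank ≤ r → r < min dx dy → min dx dy < n →
        -- the bias terms vanish
        LoRA.lambdaMax (LoRA.popCov μ) *
            (r * LoRA.sigma (Astar - A₀) (r + 1) ^ 2 +
              ∑ i ∈ Finset.Icc (r + 1) (min dx dy), LoRA.sigma (Astar - A₀) i ^ 2) = 0 ∧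
        ENNReal.ofReal (r * LoRA.sigma (Astar - A₀) (r + 1) ^ 2) *
            ∫⁻ ω, ENNReal.ofReal
              (LoRA.lambdaMax (LoRA.empCov (LoRA.colMatrix fun i => x i ω)) *
                LoRA.lambdaMax (LoRA.popCov μ *
                  (LoRA.empCov (LoRA.colMatrix fun i => x i ω))⁻¹)) ∂P = 0 ∧
        -- the excess risk bound
        LoRA.risk (LoRA.sampleLaw Astar μ S) Astar ≠ ∞ ∧
        (∫⁻ ω, LoRA.risk (LoRA.sampleLaw Astar μ S) (Ahat ω) ∂P) -
            LoRA.risk (LoRA.sampleLaw Astar μ S) Astar ≤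
          ENNReal.ofReal (C * (r * (max dx dy : ℕ) / n) * LoRA.lambdaMax S) *
            ∫⁻ ω, ENNReal.ofReal (LoRA.lambdaMax (LoRA.popCov μ *
              (LoRA.empCov (LoRA.colMatrix fun i => x i ω))⁻¹)) ∂P := by
  -- `2048 = 8 * 64 * 4`: low-rank least squares, the Gaussian supremum, and `dx + dy + 2 ≤ 4 * max
  -- dx dy`.
  refine ⟨2048, by norm_num, ?_⟩
  intro dx dy n r Astar A₀ μ _ S Ω _ P _ x y Ahat hμ _ hS hind hlaw hunit _ hsol hr hrd hdn
  have hn : 0 < n := by omega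
  have hsig : ∀ i, r + 1 ≤ i → LoRA.sigma (Astar - A₀) i = 0 := fun i hi =>
    LoRA.sigma_eq_zero _ hr hi
  refine ⟨?_, ?_, ?_, ?_⟩
  · rw [hsig _ le_rfl, Finset.sum_eq_zero fun i hi => by
      rw [hsig i (Finset.mem_Icc.1 hi).1, zero_pow two_ne_zero]]
    simp
  · rw [hsig _ le_rfl]
    simp
  · rw [LoRA.risk_sampleLaw hμ]
    simpa using LoRA.noiseRisk_ne_top S
  have hQ := LoRA.posSemidef_popCov hμ
  have hL := LoRA.lambdaMax_nonneg hS
  set Q := LoRA.popCov μ with hQdef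
  have hZ := LoRA.hasLaw_features_noise hind hlaw
  set c : ℝ≥0∞ := ENNReal.ofReal (64 * LoRA.lambdaMax S * (dx + dy + 2)) with hc
  have hprod : ∫⁻ ω, LoRA.covRatio Q (LoRA.colMatrix fun i => x i ω) *
      LoRA.noiseSup (LoRA.colMatrix fun i => x i ω)
        (LoRA.colMatrix fun i => y i ω - Matrix.toEuclideanLin Astar (x i ω)) ∂P ≤
      c * ∫⁻ ω, ENNReal.ofReal (LoRA.lambdaMax
        (Q * (LoRA.empCov (LoRA.colMatrix fun i => x i ω))⁻¹)) ∂P := by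
    refine (LoRA.lintegral_covRatio_mul_noiseSup_le hS Q hZ).trans ?_
    refine mul_le_mul_right (lintegral_mono_ae ?_) _
    filter_upwards [hunit] with ω hω
    exact LoRA.covRatio_le hQ hω
  simp_rw [LoRA.risk_sampleLaw hμ]
  -- The noise risk is the same constant on both sides; it is finite, so truncated subtraction in
  -- `[0, ∞]` cancels it exactly.
  rw [lintegral_add_right _ measurable_const, lintegral_const, measure_univ, mul_one, sub_self,
    Matrix.zero_mul, Matrix.zero_mul, Matrix.trace_zero, ENNReal.ofReal_zero, zero_add,
    ENNReal.add_sub_cancel_right (LoRA.noiseRisk_ne_top S)]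
  calc _ ≤ ∫⁻ ω, ENNReal.ofReal (8 * r / n) * (LoRA.covRatio Q (LoRA.colMatrix fun i => x i ω) *
        LoRA.noiseSup (LoRA.colMatrix fun i => x i ω)
          (LoRA.colMatrix fun i => y i ω - Matrix.toEuclideanLin Astar (x i ω))) ∂P := by
        refine lintegral_mono_ae ?_
        filter_upwards [hunit, hsol] with ω hω hsolω
        rw [← LoRA.colMatrix_sub_mul_colMatrix]
        exact LoRA.trace_popCov_le_of_isLoRASolution hn hrd hQ hω hr hsolω
    _ ≤ ENNReal.ofReal (8 * r / n) * (c * ∫⁻ ω, ENNReal.ofReal (LoRA.lambdaMax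
        (Q * (LoRA.empCov (LoRA.colMatrix fun i => x i ω))⁻¹)) ∂P) := by
        rw [lintegral_const_mul' _ _ ENNReal.ofReal_ne_top]
        gcongr
    _ ≤ _ := by
        rw [← mul_assoc, hc, ← ENNReal.ofReal_mul (by positivity)]
        gcongr ENNReal.ofReal ?_ * _
        -- Uses `max dx dy ≥ 1`, which follows from `r < min dx dy`.
        have h1 : ((dx : ℝ) + dy + 2) ≤ 4 * (max dx dy : ℕ) := by
          have : dx + dy + 2 ≤ 4 * max dx dy := by omega
          exact_mod_cast this
        calc 8 * (r : ℝ) / n * (64 * LoRA.lambdaMax S * (dx + dy + 2))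
            ≤ 8 * (r : ℝ) / n * (64 * LoRA.lambdaMax S * (4 * (max dx dy : ℕ))) := by gcongr
          _ = _ := by ring
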